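/- Let $g\ge 4$ and $r\ge 3$ be integers, and let $G(g,r)$ be the family of all finite, nonempty, simple, $r$-regular graphs $G=(V,E)$ with girth at least $g$. Let $W$ be a non-negative real random variable with distribution function $F$, density $f$ and $\mathbb{E}[W]<\infty$. Equip the edges of each graph $G\in G(g,r)$ with i.i.d. weights $(W_e)_{e\in E}$ distributed as $W$. Let $\mathcal{MG}$ be the matching produced by the greedy algorithm, which repeatedly selects the edge of greatest weight among the remaining edges and deletes it together with all edges sharing a vertex with it, until no edge remains (almost surely, all the weights are distinct). Let $W[\mathcal{MG}]=\sum_{e\in\mathcal{MG}}W_e$. Then \begin{align*} &\frac r2\int_0^\infty x\,\bigl(r-1-(r-2)F(x)\bigr)^{-\frac{2(r-1)}{r-2}}f(x)\,dx-\mathbb{E}[W]\,\frac{r(r-1)^{\lfloor (g-2)/2\rfloor}}{\lfloor (g-2)/2\rfloor!}\\ &\qquad\le\inf_{G\in G(g,r)}\mathbb{E}\!\left[\frac{W[\mathcal{MG}]}{|V|}\right]\le\sup_{G\in G(g,r)}\mathbb{E}\!\left[\frac{W[\mathcal{MG}]}{|V|}\right]\\ &\qquad\le\frac r2\int_0^\infty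 x\,\bigl(r-1-(r-2)F(x)\bigr)^{-\frac{2(r-1)}{r-2}}f(x)\,dx+\mathbb{E}[W]\,\frac{r(r-1)^{\lfloor (g-2)/2\rfloor}}{\lfloor (g-2)/2\rfloor!}. \end{align*} -/

import Mathlib

open MeasureTheory ProbabilityTheory

universe u v

/-- The greedy matching algorithm on the edges of `G` with edge weights `w`, started from a set `S`
of remaining edges: as long as edges remain, select a remaining edge of greatest weight, and delete
it together with all the remaining edges that share a vertex with it. The value is the set of
selected edges. (The choice between several heaviest edges is arbitrary; for independent weights
with a continuous distribution there is almost surely no choice.) -/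
noncomputable def greedyFrom {V : Type*} {G : SimpleGraph V} (w : G.edgeSet → ℝ)
    (S : Finset G.edgeSet) : Finset G.edgeSet :=
  open Classical in
  if h : S.Nonempty then
    insert (S.exists_max_image w h).choose
      (greedyFrom w (S.filter fun e' =>
        ¬ ∃ v, v ∈ ((S.exists_max_image w h).choose : Sym2 V) ∧ v ∈ (e' : Sym2 V)))
  else ∅
termination_by S.card
decreasing_by
  classical
  refine Finset.card_lt_card (Finset.filter_ssubset.2
    ⟨_, (S.exists_max_image w h).choose_spec.1, ?_⟩)
  exact not_not.2 ⟨_, Sym2.out_fst_mem _, Sym2.out_fst_mem _⟩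

/-- The greedy matching of the finite graph `G` with edge weights `w`. -/
noncomputable def greedyMatching {V : Type*} [Finite V] (G : SimpleGraph V) (w : G.edgeSet → ℝ) :
    Finset G.edgeSet :=
  haveI := Fintype.ofFinite G.edgeSet
  greedyFrom w Finset.univ

/-- The total weight of the greedy matching. -/
noncomputable def greedyWeight {V : Type*} [Finite V] (G : SimpleGraph V) (w : G.edgeSet → ℝ) :
    ℝ :=
  ∑ e ∈ greedyMatching G w, w e

/-- The expected weight per vertex of the greedy matching of `G`, when the edge weights are
independent with common law `μ`. -/
noncomputable def expectedGreedyWeight (μ : Measure ℝ) {V : Type*} [Finite V]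
    (G : SimpleGraph V) : ℝ :=
  haveI := Fintype.ofFinite G.edgeSet
  ∫ w, greedyWeight G w / (Nat.card V : ℝ) ∂(Measure.pi fun _ : G.edgeSet => μ)

/-- `G` is `r`-regular with girth at least `g`. -/
def RegularGirth {V : Type*} (G : SimpleGraph V) (g r : ℕ) : Prop :=
  (∃ _ : G.LocallyFinite, G.IsRegularOfDegree r) ∧ (g : ℕ∞) ≤ G.egirth

/-- The values, in the extended reals, of the expected weight per vertex of the greedy matching
over all finite nonempty `r`-regular graphs of girth at least `g`. -/
def greedyValues (μ : Measure ℝ) (g r : ℕ) : Set EReal :=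
  {x | ∃ (V : Type u) (_ : Finite V) (_ : Nonempty V) (G : SimpleGraph V),
    RegularGirth G g r ∧ x = (expectedGreedyWeight μ G : EReal)}

/-- The main term
`(r / 2) ∫₀^∞ x (r - 1 - (r - 2) F(x)) ^ (-2(r-1)/(r-2)) f(x) dx`, with `F` the distribution
function of `μ`. -/
noncomputable def matchingMain (μ : Measure ℝ) (f : ℝ → ℝ) (r : ℕ) : ℝ :=
  (r : ℝ) / 2 * ∫ x in Set.Ioi (0 : ℝ),
    x * ((r : ℝ) - 1 - ((r : ℝ) - 2) * cdf μ x) ^ (-(2 * ((r : ℝ) - 1) / ((r : ℝ) - 2))) * f x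

/-! When the weights are distinct, an edge is selected exactly when no heavier edge touching it is
selected. Whether `uv` is selected is therefore decided by explorations away from both ends along
edges of increasing weight: `v` is available if no heavier edge at `v` leads on to an available
vertex. An edge is selected iff both its ends are available (`mem_greedyMatching_iff_avail`).

Put `d = r - 1` and `k = ⌊(g-2)/2⌋`, and truncate the exploration at depth `k`. Since `2k + 1 < g`,
the explored region is a tree. Given the weight `x` of the edge, its two sides are independent, and
each is available with probability `availProb μ d k x`, where `p₀ = 1` and `pₙ₊₁(x) = (1 - ∫_{y>x}
pₙ dμ)^d`. In terms of the tail `T = 1 - F`, which is uniform on `[0,1]` under `μ`, the fixed point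
of this recursion is `(1 + (d-1)T)^(-d/(d-1))`. Its square is the power in the main term.

Two errors are estimated. Truncating on the graph matters only if an increasing path of `k` edges
leaves one of the ends (`chain_of_avail_ne`). On the tree, `pₖ` differs from its limit by at most
`(dT)^k/k!`. Each error costs at most `2 E[W] d^k/k!` per edge. They do not add up: truncation at
even depth overestimates, and at odd depth underestimates, both the graph value and the tree limit.
Summing over `r/2` edges per vertex gives the bound. -/

/-! ### The greedy algorithm and its local characterization -/

section Greedy

variable {V : Type*} {G : SimpleGraph V}

theorem greedyFrom_empty (w : G.edgeSet → ℝ) : greedyFrom w ∅ = ∅ := by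
  rw [greedyFrom]; simp

/-- One step of the greedy algorithm, with the selected edge made explicit. -/
theorem greedyFrom_step (w : G.edgeSet → ℝ) {S : Finset G.edgeSet} (h : S.Nonempty) :
    ∃ m ∈ S, (∀ e ∈ S, w e ≤ w m) ∧ ∃ T ⊂ S,
      (∀ e, e ∈ T ↔ e ∈ S ∧ ¬ ∃ v, v ∈ (m : Sym2 V) ∧ v ∈ (e : Sym2 V)) ∧
      ∀ e, e ∈ greedyFrom w S ↔ e = m ∨ e ∈ greedyFrom w T := by
  classical
  refine ⟨(S.exists_max_image w h).choose, (S.exists_max_image w h).choose_spec.1,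
    (S.exists_max_image w h).choose_spec.2,
    S.filter fun e' => ¬ ∃ v, v ∈ ((S.exists_max_image w h).choose : Sym2 V) ∧
      v ∈ (e' : Sym2 V), ?_, ?_, ?_⟩
  · exact Finset.filter_ssubset.2 ⟨_, (S.exists_max_image w h).choose_spec.1,
      not_not.2 ⟨_, Sym2.out_fst_mem _, Sym2.out_fst_mem _⟩⟩
  · intro e
    simp
  · intro e
    rw [greedyFrom, dif_pos h, Finset.mem_insert]

theorem greedyFrom_subset (w : G.edgeSet → ℝ) (S : Finset G.edgeSet) : greedyFrom w S ⊆ S := by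
  induction S using Finset.strongInduction with
  | H S ih =>
    rcases S.eq_empty_or_nonempty with rfl | h
    · simp [greedyFrom_empty]
    · obtain ⟨m, hm, -, T, hT, -, hg⟩ := greedyFrom_step w h
      intro e he
      rcases (hg e).1 he with rfl | he
      · exact hm
      · exact hT.1 (ih T hT he)

/-- The greedy algorithm selects pairwise disjoint edges. -/
theorem greedyFrom_disjoint (w : G.edgeSet → ℝ) (S : Finset G.edgeSet) {e e' : G.edgeSet}
    (he : e ∈ greedyFrom w S) (he' : e' ∈ greedyFrom w S)
    (h : ∃ v, v ∈ (e : Sym2 V) ∧ v ∈ (e' : Sym2 V)) : e = e' := by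
  induction S using Finset.strongInduction with
  | H S ih =>
    rcases S.eq_empty_or_nonempty with rfl | hS
    · simp [greedyFrom_empty] at he
    · obtain ⟨m, hm, -, T, hT, hTm, hg⟩ := greedyFrom_step w hS
      rcases (hg e).1 he with h1 | h1 <;> rcases (hg e').1 he' with h2 | h2
      · rw [h1, h2]
      · subst h1
        exact absurd h ((hTm e').1 (greedyFrom_subset w T h2)).2
      · subst h2
        obtain ⟨v, hv, hv'⟩ := h
        exact absurd ⟨v, hv', hv⟩ ((hTm e).1 (greedyFrom_subset w T h1)).2
      · exact ih T hT h1 h2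

/-- An edge that is not selected touches a selected edge that is at least as heavy. -/
theorem exists_mem_greedyFrom (w : G.edgeSet → ℝ) (S : Finset G.edgeSet) {e : G.edgeSet}
    (he : e ∈ S) :
    ∃ e' ∈ greedyFrom w S, (∃ v, v ∈ (e' : Sym2 V) ∧ v ∈ (e : Sym2 V)) ∧ w e ≤ w e' := by
  induction S using Finset.strongInduction with
  | H S ih =>
    obtain ⟨m, hm, hmax, T, hT, hTm, hg⟩ := greedyFrom_step w ⟨e, he⟩
    by_cases h : ∃ v, v ∈ (m : Sym2 V) ∧ v ∈ (e : Sym2 V)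
    · exact ⟨m, (hg m).2 (Or.inl rfl), h, hmax e he⟩
    · obtain ⟨e', he', h'⟩ := ih T hT ((hTm e).2 ⟨he, h⟩)
      exact ⟨e', (hg e').2 (Or.inr he'), h'⟩

/-- Injectivity turns "at least as heavy" in `exists_mem_greedyFrom` into "equal or strictly
heavier", which yields a recursion on the weight that no longer mentions the algorithm. -/
theorem mem_greedyMatching_iff [Finite V] {w : G.edgeSet → ℝ} (hw : Function.Injective w)
    (e : G.edgeSet) :
    e ∈ greedyMatching G w ↔ ∀ e' : G.edgeSet, (∃ v, v ∈ (e' : Sym2 V) ∧ v ∈ (e : Sym2 V)) →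
      w e < w e' → e' ∉ greedyMatching G w := by
  constructor
  · intro he e' hv hlt he'
    have := greedyFrom_disjoint w _ he' he hv
    rw [this] at hlt
    exact lt_irrefl _ hlt
  · intro h
    have := Fintype.ofFinite G.edgeSet
    obtain ⟨e', he', hv, hle⟩ := exists_mem_greedyFrom w Finset.univ (Finset.mem_univ e)
    rcases hle.eq_or_lt with heq | hlt
    · have h1 := hw heq
      rw [h1]
      unfold greedyMatching
      convert he'
    · refine absurd ?_ (h e' hv hlt)
      unfold greedyMatching
      convert he'

end Greedy

/-! ### Availability and increasing paths -/

section Avail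

variable {V : Type*} (G : SimpleGraph V)

/-- The far end `v` of a dart `u → v` of weight `x` is available, as seen by exploring `n` levels
beyond `v`: no heavier edge at `v` leads to a vertex that is available with one level less. -/
def Avail (w : Sym2 V → ℝ) : ℕ → V → V → ℝ → Prop
  | 0, _, _, _ => True
  | n + 1, u, v, x => ∀ c, G.Adj v c → c ≠ u → x < w s(v, c) → ¬ Avail w n v c (w s(v, c))

/-- There is a non-backtracking continuation of the dart `u → v` of weight `x` by `n` edges
of increasing weights. -/
def Chain (w : Sym2 V → ℝ) : ℕ → V → V → ℝ → Prop
  | 0, _, _, _ => True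
  | n + 1, u, v, x => ∃ c, G.Adj v c ∧ c ≠ u ∧ x < w s(v, c) ∧ Chain w n v c (w s(v, c))

variable {G} {w : Sym2 V → ℝ}

/-- Level `0` is the largest possible answer and each further level negates. So even truncations
overestimate every deeper exploration and odd ones underestimate it. -/
theorem avail_add_of_even : ∀ (n : ℕ) (m : ℕ) (u v : V) (x : ℝ),
    (Even n → Avail G w (n + m) u v x → Avail G w n u v x) ∧
    (Odd n → Avail G w n u v x → Avail G w (n + m) u v x)
  | 0, m, u, v, x => by simp [Avail]
  | n + 1, m, u, v, x => by
    rw [Nat.add_right_comm n 1 m]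
    constructor
    · intro hn h c hc hcu hx hA
      have hn' : Odd n := by
        rcases Nat.even_or_odd n with h | h
        · exact absurd hn (Nat.not_even_iff_odd.2 h.add_one)
        · exact h
      exact h c hc hcu hx ((avail_add_of_even n m _ _ _).2 hn' hA)
    · intro hn h c hc hcu hx hA
      have hn' : Even n := by
        rcases Nat.even_or_odd n with h | h
        · exact h
        · exact absurd hn (Nat.not_odd_iff_even.2 h.add_one)
      exact h c hc hcu hx ((avail_add_of_even n m _ _ _).1 hn' hA)

/-- A disagreement between two depths must come from a disagreement one level down, across a heavier
edge; following it down traces an increasing path. -/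
theorem chain_of_avail_ne : ∀ (n : ℕ) (m : ℕ) (u v : V) (x : ℝ),
    ¬ (Avail G w n u v x ↔ Avail G w (n + m) u v x) → Chain G w n u v x
  | 0, m, u, v, x => by simp [Chain]
  | n + 1, m, u, v, x => by
    rw [Nat.add_right_comm n 1 m]
    intro h
    by_contra hc
    refine h (forall_congr' fun c => forall_congr' fun h1 => forall_congr' fun h2 =>
      forall_congr' fun h3 => not_congr ?_)
    by_contra hne
    exact hc ⟨c, h1, h2, h3, chain_of_avail_ne n m _ _ _ hne⟩

/-- Weights strictly increase along the exploration, so each level uses up at least one heavier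
edge, and deeper levels add nothing once these are exhausted. -/
theorem avail_succ_iff [Finite V] : ∀ (n : ℕ) (u v : V) (x : ℝ),
    {e ∈ G.edgeSet | x < w e}.ncard ≤ n → (Avail G w n u v x ↔ Avail G w (n + 1) u v x)
  | 0, u, v, x => by
    intro h
    have h0 : {e ∈ G.edgeSet | x < w e} = ∅ := by
      rw [← Set.ncard_eq_zero (Set.toFinite _)]; omega
    simp only [Avail, true_iff]
    intro c hc _ hx _
    have : s(v, c) ∈ {e ∈ G.edgeSet | x < w e} := ⟨hc, hx⟩
    simp [h0] at this
  | n + 1, u, v, x => by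
    intro h
    refine forall_congr' fun c => forall_congr' fun h1 => forall_congr' fun h2 =>
      forall_congr' fun h3 => not_congr (avail_succ_iff n _ _ _ ?_)
    have : {e ∈ G.edgeSet | w s(v, c) < w e} ⊂ {e ∈ G.edgeSet | x < w e} := by
      refine ⟨fun e he => ⟨he.1, h3.trans he.2⟩, fun hs => ?_⟩
      exact lt_irrefl _ (hs (show s(v, c) ∈ _ from ⟨h1, h3⟩)).2
    have := Set.ncard_lt_ncard this (Set.toFinite _)
    omega

/-- The edge is selected by the greedy algorithm if and only if both of its ends are available. -/
theorem mem_greedyMatching_iff_avail [Finite V] {w' : G.edgeSet → ℝ}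
    (hw' : Function.Injective w') (hw : ∀ e : G.edgeSet, w (e : Sym2 V) = w' e) {N : ℕ}
    (hN : G.edgeSet.ncard ≤ N) (u v : V) (h : G.Adj u v) :
    (⟨s(u, v), h⟩ : G.edgeSet) ∈ greedyMatching G w' ↔
      Avail G w N u v (w s(u, v)) ∧ Avail G w N v u (w s(u, v)) := by
  have hfix (u v x) : Avail G w N u v x ↔
      ∀ c, G.Adj v c → c ≠ u → x < w s(v, c) → ¬ Avail G w N v c (w s(v, c)) :=
    avail_succ_iff N u v x ((Set.ncard_le_ncard (Set.sep_subset _ _) (Set.toFinite _)).trans hN)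
  -- The induction is on the number of edges heavier than `uv`.
  have key : ∀ (n : ℕ) (u v : V) (h : G.Adj u v),
      {e ∈ G.edgeSet | w s(u, v) < w e}.ncard = n →
      ((⟨s(u, v), h⟩ : G.edgeSet) ∈ greedyMatching G w' ↔
      Avail G w N u v (w s(u, v)) ∧ Avail G w N v u (w s(u, v))) := by
    intro n
    induction n using Nat.strong_induction_on with
    | _ n ih =>
      intro u v h hn
      have ih' (a b : V) (hab : G.Adj a b) (hlt : w s(u, v) < w s(a, b)) :
          ((⟨s(a, b), hab⟩ : G.edgeSet) ∈ greedyMatching G w' ↔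
            Avail G w N a b (w s(a, b)) ∧ Avail G w N b a (w s(a, b))) := by
        refine ih _ ?_ a b hab rfl
        rw [← hn]
        refine Set.ncard_lt_ncard ⟨fun e he => ⟨he.1, hlt.trans he.2⟩, fun hs => ?_⟩
          (Set.toFinite _)
        exact lt_irrefl _ (hs (show s(a, b) ∈ _ from ⟨hab, hlt⟩)).2
      have hside (u v : V) (h : G.Adj u v) (hle : {e ∈ G.edgeSet | w s(u, v) < w e}.ncard = n)
          (ih' : ∀ (a b : V) (hab : G.Adj a b) (_ : w s(u, v) < w s(a, b)),
          ((⟨s(a, b), hab⟩ : G.edgeSet) ∈ greedyMatching G w' ↔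
            Avail G w N a b (w s(a, b)) ∧ Avail G w N b a (w s(a, b))))
          (hm : (⟨s(u, v), h⟩ : G.edgeSet) ∈ greedyMatching G w') :
          Avail G w N u v (w s(u, v)) := by
        by_contra hA
        set S : Set V := {c | G.Adj v c ∧ c ≠ u ∧ w s(u, v) < w s(v, c) ∧
          Avail G w N v c (w s(v, c))} with hS
        have hSne : S.Nonempty := by
          rw [hfix] at hA
          push Not at hA
          obtain ⟨c, h1, h2, h3, h4⟩ := hA
          exact ⟨c, h1, h2, h3, h4⟩
        -- Take the heaviest edge `vc` that blocks `v`. By maximality nothing heavier at `v` leads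
        -- to an available vertex, so `v` is available from `c` too. By induction `vc` is selected,
        -- which excludes `uv`.
        obtain ⟨c, ⟨hc1, hc2, hc3, hc4⟩, hmax⟩ :=
          Set.exists_max_image S (fun c => w s(v, c)) (Set.toFinite _) hSne
        have hA' : Avail G w N c v (w s(v, c)) := by
          rw [hfix]
          intro d hd hdc hlt hAd
          have hdu : d ≠ u := by
            rintro rfl
            rw [Sym2.eq_swap] at hc3
            exact lt_asymm hlt hc3
          exact absurd (hmax d ⟨hd, hdu, hc3.trans hlt, hAd⟩) (not_le.2 hlt)
        have hmem := (ih' v c hc1 hc3).2 ⟨hc4, hA'⟩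
        refine (mem_greedyMatching_iff hw' _).1 hm ⟨s(v, c), hc1⟩ ⟨v, ?_, ?_⟩ ?_ hmem
        · simp
        · simp
        · rw [← hw, ← hw]; exact hc3
      constructor
      · intro hm
        refine ⟨hside u v h hn ih' hm, ?_⟩
        have h2 := hside v u h.symm (by rw [Sym2.eq_swap]; exact hn)
          (by rw [Sym2.eq_swap]; exact ih') (by convert hm using 1; exact Subtype.ext Sym2.eq_swap)
        rwa [Sym2.eq_swap] at h2
      · rintro ⟨h1, h2⟩
        rw [mem_greedyMatching_iff hw']
        rintro ⟨e', he'⟩ ⟨a, ha, ha'⟩ hlt hm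
        rw [← hw, ← hw] at hlt
        change w s(u, v) < w e' at hlt
        obtain ⟨b, rfl⟩ := ha
        have hab : G.Adj a b := he'
        have hav := (ih' a b hab hlt).1 hm
        simp only [Sym2.mem_iff] at ha'
        rcases ha' with rfl | rfl
        · refine (hfix _ _ _).1 h2 b hab ?_ hlt hav.1
          rintro rfl
          exact lt_irrefl _ hlt
        · refine (hfix _ _ _).1 h1 b hab ?_ hlt hav.1
          rintro rfl
          rw [Sym2.eq_swap] at hlt
          exact lt_irrefl _ hlt
  exact key _ u v h rfl

end Avail

/-! ### Explorations below the girth are trees -/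

section Girth

variable {V : Type*} {G : SimpleGraph V}

open SimpleGraph

/-- Two different paths with the same ends close up to a cycle. -/
theorem egirth_le_of_isPath_ne {a b : V} {p q : G.Walk a b} (hp : p.IsPath) (hq : q.IsPath)
    (hne : p ≠ q) : G.egirth ≤ (p.length + q.length : ℕ) := by
  classical
  by_contra! hlt
  -- A cycle in the union `H` of the two paths has at most `p.length + q.length` edges. If the girth
  -- is larger, `H` is a forest, where paths are unique.
  set H : SimpleGraph V := fromEdgeSet {e | e ∈ p.edges ∨ e ∈ q.edges} with hH
  have hpH : ∀ e ∈ p.edges, e ∈ H.edgeSet := fun e he => by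
    rw [hH, edgeSet_fromEdgeSet]
    exact ⟨Or.inl he, G.not_isDiag_of_mem_edgeSet (p.edges_subset_edgeSet he)⟩
  have hqH : ∀ e ∈ q.edges, e ∈ H.edgeSet := fun e he => by
    rw [hH, edgeSet_fromEdgeSet]
    exact ⟨Or.inr he, G.not_isDiag_of_mem_edgeSet (q.edges_subset_edgeSet he)⟩
  have hHG : H ≤ G := by
    intro x y hxy
    rw [hH, fromEdgeSet_adj] at hxy
    rcases hxy.1 with h | h
    · exact p.adj_of_mem_edges h
    · exact q.adj_of_mem_edges h
  have hac : H.IsAcyclic := by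
    intro c r hr
    have h1 : G.egirth ≤ r.length := by
      have := egirth_le_length (hr.mapLe hHG)
      simpa using this
    have h2 : r.edges.toFinset ⊆ (p.edges ++ q.edges).toFinset := by
      intro e he
      have := r.edges_subset_edgeSet (List.mem_toFinset.1 he)
      rw [hH, edgeSet_fromEdgeSet] at this
      simpa using this.1
    have h3 : r.length ≤ p.length + q.length := by
      rw [← r.length_edges, ← List.toFinset_card_of_nodup hr.isTrail.edges_nodup]
      refine (Finset.card_le_card h2).trans ((List.toFinset_card_le _).trans ?_)
      simp
    exact absurd (hlt.trans_le h1) (not_lt.2 (by exact_mod_cast h3))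
  have := (hac.subsingleton_path a b).elim ⟨p.transfer H hpH, hp.transfer hpH⟩
    ⟨q.transfer H hqH, hq.transfer hqH⟩
  have h4 : p.transfer H hpH = q.transfer H hqH := congrArg Subtype.val this
  refine hne (Walk.ext_support ?_)
  have := congrArg Walk.support h4
  simpa using this

variable (G) in
/-- The edges on which the availability of the dart `u → v`, explored to `n` levels, depends. -/
def Explored : ℕ → V → V → Set (Sym2 V)
  | 0, _, _ => ∅
  | n + 1, u, v => {e | ∃ c, G.Adj v c ∧ c ≠ u ∧ (e = s(v, c) ∨ e ∈ Explored n v c)}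

/-- The path is extended at its front; a front vertex already on it would close a cycle of length at
most `n + 1`. -/
theorem exists_isPath_of_mem_explored : ∀ (n : ℕ) (u v : V) (h : G.Adj u v) (e : Sym2 V),
    ((n + 1 : ℕ) : ℕ∞) < G.egirth → e ∈ Explored G n u v →
    ∃ (b : V) (q : G.Walk v b), (Walk.cons h q).IsPath ∧ q.length ≤ n ∧ e ∈ q.edges
  | 0, u, v, h, e, _, he => by simp [Explored] at he
  | n + 1, u, v, h, e, hg, he => by
    classical
    obtain ⟨c, hc, hcu, he⟩ := he
    have hg' : ((n + 1 : ℕ) : ℕ∞) < G.egirth := lt_trans (by exact_mod_cast Nat.lt_succ_self _) hg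
    have hq : ∃ (b : V) (q : G.Walk c b), (Walk.cons hc q).IsPath ∧ q.length ≤ n ∧
        e ∈ (Walk.cons hc q).edges := by
      rcases he with rfl | he
      · exact ⟨c, Walk.nil, by simp [hc.ne], by simp, by simp⟩
      · obtain ⟨b, q, h1, h2, h3⟩ := exists_isPath_of_mem_explored n v c hc e hg' he
        exact ⟨b, q, h1, h2, by simp [h3]⟩
    obtain ⟨b, q, h1, h2, h3⟩ := hq
    refine ⟨b, Walk.cons hc q, ?_, by simpa using h2, h3⟩
    rw [Walk.cons_isPath_iff]
    refine ⟨h1, fun hu => ?_⟩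
    rw [Walk.support_cons, List.mem_cons] at hu
    rcases hu with hu | hu
    · exact h.ne hu
    · have hcyc : (Walk.cons h (Walk.cons hc (q.takeUntil u hu))).IsCycle := by
        rw [Walk.cons_isPath_iff] at h1
        have hvs : v ∉ (q.takeUntil u hu).support :=
          fun hv => h1.2 (q.support_takeUntil_subset_support hu hv)
        rw [Walk.cons_isCycle_iff, Walk.cons_isPath_iff]
        refine ⟨⟨h1.1.takeUntil hu, hvs⟩, ?_⟩
        rw [Walk.edges_cons, List.mem_cons]
        rintro (h5 | h5)
        · rw [Sym2.eq_swap, Sym2.congr_right] at h5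
          exact hcu h5.symm
        · exact hvs (Walk.snd_mem_support_of_mem_edges _ h5)
      have h6 := egirth_le_length hcyc
      have h7 : (Walk.cons h (Walk.cons hc (q.takeUntil u hu))).length ≤ n + 1 + 1 := by
        have := q.length_takeUntil_le_length hu
        simp only [Walk.length_cons]
        omega
      exact absurd (hg.trans_le h6) (not_lt.2 (by exact_mod_cast h7))

theorem edge_notMem_explored {n : ℕ} {u v : V} (h : G.Adj u v)
    (hg : ((n + 1 : ℕ) : ℕ∞) < G.egirth) : s(u, v) ∉ Explored G n u v := by
  intro he
  obtain ⟨b, q, h1, -, h3⟩ := exists_isPath_of_mem_explored n u v h _ hg he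
  exact ((Walk.cons_isPath_iff _ _).1 h1).2 (q.fst_mem_support_of_mem_edges h3)

/-- A common edge has an endpoint other than `v`. The two branches give paths to it from `v` with
different first steps and total length at most `2(n + 1)`. -/
theorem disjoint_explored_branches {n : ℕ} {v c c' : V} (hc : G.Adj v c) (hc' : G.Adj v c')
    (hne : c ≠ c') (hg : ((2 * (n + 1) : ℕ) : ℕ∞) < G.egirth) :
    Disjoint (insert s(v, c) (Explored G n v c)) (insert s(v, c') (Explored G n v c')) := by
  classical
  have hg' : ((n + 1 : ℕ) : ℕ∞) < G.egirth := lt_of_le_of_lt (by norm_cast; omega) hg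
  have hpath (c : V) (hc : G.Adj v c) (e : Sym2 V) (he : e ∈ insert s(v, c) (Explored G n v c)) :
      ∃ (b : V) (q : G.Walk c b), (Walk.cons hc q).IsPath ∧ q.length ≤ n ∧
        ∀ x ∈ e, x ≠ v → x ∈ q.support := by
    rcases he with rfl | he
    · refine ⟨c, Walk.nil, by simp [hc.ne], by simp, ?_⟩
      intro x hx hxv
      simpa [hxv] using hx
    · obtain ⟨b, q, h1, h2, h3⟩ := exists_isPath_of_mem_explored n v c hc e hg' he
      exact ⟨b, q, h1, h2, fun x hx _ => q.mem_support_of_mem_edges h3 hx⟩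
  rw [Set.disjoint_left]
  intro e he he'
  have hx : ∃ x ∈ e, x ≠ v := by
    obtain ⟨b, q, h1, h2, h3⟩ := hpath c hc e he
    induction e using Sym2.ind with
    | _ a b =>
      by_cases hab : a = v
      · refine ⟨b, by simp, ?_⟩
        rintro rfl
        subst hab
        rcases he with he | he
        · rw [Sym2.congr_right] at he
          exact hc.ne he
        · obtain ⟨b, q, h1, h2, h3⟩ := exists_isPath_of_mem_explored n _ c hc _ hg' he
          exact (q.adj_of_mem_edges h3).ne rfl
      · exact ⟨a, by simp, hab⟩
  obtain ⟨x, hxe, hxv⟩ := hx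
  obtain ⟨b, q, h1, h2, h3⟩ := hpath c hc e he
  obtain ⟨b', q', h1', h2', h3'⟩ := hpath c' hc' e he'
  have hxq := h3 x hxe hxv
  have hxq' := h3' x hxe hxv
  rw [Walk.cons_isPath_iff] at h1 h1'
  have hp : (Walk.cons hc (q.takeUntil x hxq)).IsPath := by
    rw [Walk.cons_isPath_iff]
    exact ⟨h1.1.takeUntil _, fun hv => h1.2 (q.support_takeUntil_subset_support _ hv)⟩
  have hp' : (Walk.cons hc' (q'.takeUntil x hxq')).IsPath := by
    rw [Walk.cons_isPath_iff]
    exact ⟨h1'.1.takeUntil _, fun hv => h1'.2 (q'.support_takeUntil_subset_support _ hv)⟩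
  have h5 := egirth_le_of_isPath_ne hp hp' (by
    intro h
    injection h with _ h6 _
    exact hne h6)
  have h6 : (Walk.cons hc (q.takeUntil x hxq)).length +
      (Walk.cons hc' (q'.takeUntil x hxq')).length ≤ 2 * (n + 1) := by
    have := q.length_takeUntil_le_length hxq
    have := q'.length_takeUntil_le_length hxq'
    simp only [Walk.length_cons]
    omega
  exact absurd (hg.trans_le h5) (not_lt.2 (by exact_mod_cast h6))

/-- An endpoint of a common edge is reached from `v` by a path of length at most `n` avoiding `u`,
and by one of length at most `n + 1` starting with `v → u`. -/
theorem disjoint_explored_sides {n : ℕ} {u v : V} (h : G.Adj u v)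
    (hg : ((2 * n + 1 : ℕ) : ℕ∞) < G.egirth) :
    Disjoint (Explored G n u v) (Explored G n v u) := by
  classical
  have hg' : ((n + 1 : ℕ) : ℕ∞) < G.egirth := lt_of_le_of_lt (by norm_cast; omega) hg
  rw [Set.disjoint_left]
  intro e he he'
  obtain ⟨b, q, h1, h2, h3⟩ := exists_isPath_of_mem_explored n u v h e hg' he
  obtain ⟨b', q', h1', h2', h3'⟩ := exists_isPath_of_mem_explored n v u h.symm e hg' he'
  obtain ⟨x, hx⟩ : ∃ x, x ∈ e := ⟨_, Sym2.out_fst_mem e⟩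
  have hxq := q.mem_support_of_mem_edges h3 hx
  have hxq' := q'.mem_support_of_mem_edges h3' hx
  rw [Walk.cons_isPath_iff] at h1 h1'
  have hp' : (Walk.cons h.symm (q'.takeUntil x hxq')).IsPath := by
    rw [Walk.cons_isPath_iff]
    exact ⟨h1'.1.takeUntil _, fun hv => h1'.2 (q'.support_takeUntil_subset_support _ hv)⟩
  have h5 := egirth_le_of_isPath_ne (h1.1.takeUntil hxq) hp' (by
    intro h
    refine h1.2 (q.support_takeUntil_subset_support hxq ?_)
    rw [h]
    simp)
  have h6 : (q.takeUntil x hxq).length +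
      (Walk.cons h.symm (q'.takeUntil x hxq')).length ≤ 2 * n + 1 := by
    have := q.length_takeUntil_le_length hxq
    have := q'.length_takeUntil_le_length hxq'
    simp only [Walk.length_cons]
    omega
  exact absurd (hg.trans_le h5) (not_lt.2 (by exact_mod_cast h6))

theorem avail_congr {w w' : Sym2 V → ℝ} : ∀ (n : ℕ) (u v : V) (x : ℝ),
    (∀ e ∈ Explored G n u v, w e = w' e) → (Avail G w n u v x ↔ Avail G w' n u v x)
  | 0, _, _, _, _ => Iff.rfl
  | n + 1, u, v, x, h => by
    refine forall_congr' fun c => forall_congr' fun h1 => forall_congr' fun h2 => ?_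
    rw [h _ ⟨c, h1, h2, Or.inl rfl⟩,
      avail_congr n v c _ fun e he => h e ⟨c, h1, h2, Or.inr he⟩]

theorem chain_congr {w w' : Sym2 V → ℝ} : ∀ (n : ℕ) (u v : V) (x : ℝ),
    (∀ e ∈ Explored G n u v, w e = w' e) → (Chain G w n u v x ↔ Chain G w' n u v x)
  | 0, _, _, _, _ => Iff.rfl
  | n + 1, u, v, x, h => by
    refine exists_congr fun c => and_congr_right fun h1 => and_congr_right fun h2 => ?_
    rw [h _ ⟨c, h1, h2, Or.inl rfl⟩,
      chain_congr n v c _ fun e he => h e ⟨c, h1, h2, Or.inr he⟩]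

end Girth

/-! ### The tail function as a uniform variable -/

section Tail

open Set

variable {μ : Measure ℝ} [IsProbabilityMeasure μ]

theorem real_Ioi_eq_one_sub_cdf (x : ℝ) : μ.real (Ioi x) = 1 - cdf μ x := by
  rw [← compl_Iic, probReal_compl_eq_one_sub measurableSet_Iic, cdf_eq_real]

theorem antitone_real_Ioi : Antitone fun x => μ.real (Ioi x) := fun _ _ h =>
  measureReal_mono (Ioi_subset_Ioi h)

theorem continuous_cdf [NullSingletonClass μ] : Continuous (cdf μ) := by
  rw [continuous_iff_continuousAt]
  intro x
  rw [(monotone_cdf μ).continuousAt_iff_leftLim_eq_rightLim, (cdf μ).rightLim_eq]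
  have h := (cdf μ).measure_singleton x
  rw [measure_cdf, measure_singleton, eq_comm, ENNReal.ofReal_eq_zero] at h
  have := (monotone_cdf μ).leftLim_le (le_refl x)
  linarith

/-- If the tail takes the value `t` at `x`, the set lies in `Ioi x`, of mass `t`. If `t < 1` is not
attained, the tail, continuous with limit `1` at `-∞`, stays above `t`, and the set is empty. -/
theorem real_tail_lt_le [NullSingletonClass μ] {t : ℝ} (ht0 : 0 ≤ t) :
    μ.real {y | μ.real (Ioi y) < t} ≤ t := by
  rcases le_or_gt 1 t with h1 | h1
  · exact measureReal_le_one.trans h1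
  by_cases hx : ∃ x, μ.real (Ioi x) = t
  · obtain ⟨x, hx⟩ := hx
    calc _ ≤ μ.real (Ioi x) := measureReal_mono fun y hy => by
            rw [mem_ofPred_eq, ← hx] at hy
            by_contra hxy
            exact absurd hy (not_lt.2 (antitone_real_Ioi (not_lt.1 hxy)))
      _ = t := hx
  · have hmem : ∀ y, t ≤ μ.real (Ioi y) := by
      intro y
      by_contra! hy
      have hb : ∃ z, t < μ.real (Ioi z) := by
        have := (tendsto_cdf_atBot μ).eventually (gt_mem_nhds (show (0 : ℝ) < 1 - t by linarith))
        obtain ⟨z, hz⟩ := this.exists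
        exact ⟨z, by rw [real_Ioi_eq_one_sub_cdf]; linarith⟩
      obtain ⟨z, hz⟩ := hb
      have hc : Continuous fun x => μ.real (Ioi x) := by
        simp_rw [real_Ioi_eq_one_sub_cdf]
        exact continuous_const.sub continuous_cdf
      exact hx (mem_range_of_exists_le_of_exists_ge hc ⟨y, hy.le⟩ ⟨z, hz.le⟩)
    have : {y | μ.real (Ioi y) < t} = ∅ := by
      ext y
      simpa using hmem y
    rw [this]
    simpa using ht0

theorem le_real_tail_le [NullSingletonClass μ] {t : ℝ} (ht0 : 0 < t) (ht1 : t ≤ 1) :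
    t ≤ μ.real {y | μ.real (Ioi y) ≤ t} := by
  by_cases hx : ∃ x, μ.real (Ioi x) = t
  · obtain ⟨x, hx⟩ := hx
    calc t = μ.real (Ioi x) := hx.symm
      _ ≤ _ := measureReal_mono fun y hy => by
        rw [mem_ofPred_eq, ← hx]
        exact antitone_real_Ioi (le_of_lt hy)
  · have hmem : ∀ y, μ.real (Ioi y) ≤ t := by
      intro y
      by_contra! hy
      have hb : ∃ z, μ.real (Ioi z) < t := by
        have := (tendsto_cdf_atTop μ).eventually (lt_mem_nhds (show 1 - t < (1 : ℝ) by linarith))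
        obtain ⟨z, hz⟩ := this.exists
        exact ⟨z, by rw [real_Ioi_eq_one_sub_cdf]; linarith⟩
      obtain ⟨z, hz⟩ := hb
      have hc : Continuous fun x => μ.real (Ioi x) := by
        simp_rw [real_Ioi_eq_one_sub_cdf]
        exact continuous_const.sub continuous_cdf
      exact hx (mem_range_of_exists_le_of_exists_ge hc ⟨z, hz.le⟩ ⟨y, hy.le⟩)
    have : {y | μ.real (Ioi y) ≤ t} = univ := by
      ext y
      simpa using hmem y
    rw [this]
    simpa using ht1

theorem measurable_real_Ioi : Measurable fun x => μ.real (Ioi x) :=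
  antitone_real_Ioi.measurable

/-- The tail function of a law without atoms is uniformly distributed under that law. -/
theorem map_real_Ioi [NullSingletonClass μ] :
    μ.map (fun x => μ.real (Ioi x)) = volume.restrict (Icc 0 1) := by
  have hp : IsProbabilityMeasure (μ.map fun x => μ.real (Ioi x)) :=
    Measure.isProbabilityMeasure_map measurable_real_Ioi.aemeasurable
  refine Measure.ext_of_Iic _ _ fun t => ?_
  have hI : Icc (0 : ℝ) 1 ∩ Iic t = Icc 0 (min 1 t) := by
    ext s; simp [and_assoc]
  rw [Measure.map_apply measurable_real_Ioi measurableSet_Iic,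
    Measure.restrict_apply measurableSet_Iic, inter_comm, hI, Real.volume_Icc,
    ← ofReal_measureReal, sub_zero]
  change ENNReal.ofReal (μ.real {y | μ.real (Ioi y) ≤ t}) = _
  rcases lt_or_ge t 0 with ht | ht
  · have : {y | μ.real (Ioi y) ≤ t} = ∅ := by
      ext y
      simpa using ht.trans_le measureReal_nonneg
    rw [this, measureReal_empty, ENNReal.ofReal_zero,
      ENNReal.ofReal_of_nonpos ((min_le_right _ _).trans ht.le)]
  congr 1
  have hle : μ.real {y | μ.real (Ioi y) ≤ t} ≤ t := le_of_forall_gt_imp_ge_of_dense fun s hs =>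
    (measureReal_mono fun y (hy : μ.real (Ioi y) ≤ t) => hy.trans_lt hs).trans
      (real_tail_lt_le (ht.trans hs.le))
  refine le_antisymm (le_min measureReal_le_one hle) ?_
  rcases ht.eq_or_lt with rfl | ht
  · simp
  · exact (le_real_tail_le (lt_min one_pos ht) (min_le_left _ _)).trans
      (measureReal_mono fun y (hy : μ.real (Ioi y) ≤ min 1 t) =>
        show μ.real (Ioi y) ≤ t from hy.trans (min_le_right _ _))

/-- Substitution `s = T(y)`. The points beyond `x` where the tail still equals `T(x)` form a null
set, because both sets have mass `T(x)`. -/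
theorem setIntegral_comp_real_Ioi [NullSingletonClass μ] {φ : ℝ → ℝ} (hφ : Measurable φ) (x : ℝ) :
    ∫ y in Ioi x, φ (μ.real (Ioi y)) ∂μ = ∫ s in (0 : ℝ)..μ.real (Ioi x), φ s := by
  have hsub : {y | μ.real (Ioi y) < μ.real (Ioi x)} ⊆ Ioi x := by
    intro y hy
    by_contra hxy
    exact absurd hy (not_lt.2 (antitone_real_Ioi (not_lt.1 hxy)))
  have hpre : {y | μ.real (Ioi y) < μ.real (Ioi x)} =
      (fun y => μ.real (Ioi y)) ⁻¹' Iio (μ.real (Ioi x)) := rfl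
  have hI : Iio (μ.real (Ioi x)) ∩ Icc 0 1 = Ico 0 (μ.real (Ioi x)) := by
    ext s
    have : μ.real (Ioi x) ≤ 1 := measureReal_le_one
    simp only [mem_inter_iff, mem_Iio, mem_Icc, mem_Ico]
    constructor
    · rintro ⟨h1, h2, h3⟩; exact ⟨h2, h1⟩
    · rintro ⟨h1, h2⟩; exact ⟨h2, h1, h2.le.trans this⟩
  have hvol : μ {y | μ.real (Ioi y) < μ.real (Ioi x)} = μ (Ioi x) := by
    rw [hpre, ← Measure.map_apply measurable_real_Ioi measurableSet_Iio, map_real_Ioi,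
      Measure.restrict_apply measurableSet_Iio, hI, Real.volume_Ico, sub_zero,
      ofReal_measureReal]
  have hae : (Ioi x : Set ℝ) =ᵐ[μ] {y | μ.real (Ioi y) < μ.real (Ioi x)} :=
    (ae_eq_of_subset_of_measure_ge hsub hvol.ge
      (measurable_real_Ioi measurableSet_Iio).nullMeasurableSet (measure_ne_top _ _)).symm
  rw [setIntegral_congr_set hae, hpre,
    ← setIntegral_map measurableSet_Iio hφ.aestronglyMeasurable measurable_real_Ioi.aemeasurable,
    map_real_Ioi, Measure.restrict_restrict measurableSet_Iio, hI,
    intervalIntegral.integral_of_le measureReal_nonneg]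
  exact setIntegral_congr_set Ico_ae_eq_Ioc

theorem setIntegral_tail_pow [NullSingletonClass μ] (n : ℕ) (x : ℝ) :
    ∫ y in Ioi x, μ.real (Ioi y) ^ n ∂μ = μ.real (Ioi x) ^ (n + 1) / (n + 1) := by
  rw [setIntegral_comp_real_Ioi (φ := fun s => s ^ n) (by fun_prop), integral_pow]
  simp

end Tail

/-! ### The recursion on the regular tree and its limit -/

section Recursion

open Set

/-- The probability that the root of the tree of depth `n` in which every vertex has `d` children
is available at weight `x`, when the edge weights are independent with law `μ`. -/
noncomputable def availProb (μ : Measure ℝ) (d : ℕ) : ℕ → ℝ → ℝ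
  | 0 => fun _ => 1
  | n + 1 => fun x => (1 - ∫ y in Ioi x, availProb μ d n y ∂μ) ^ d

/-- The limit of `availProb` as the depth of the tree grows. -/
noncomputable def availProbLim (μ : Measure ℝ) (d : ℕ) (x : ℝ) : ℝ :=
  (1 + ((d : ℝ) - 1) * μ.real (Ioi x)) ^ (-((d : ℝ) / ((d : ℝ) - 1)))

variable {μ : Measure ℝ} [IsProbabilityMeasure μ] {d : ℕ}

theorem setIntegral_mem_Icc {h : ℝ → ℝ} (h0 : ∀ x, 0 ≤ h x) (h1 : ∀ x, h x ≤ 1) (s : Set ℝ) :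
    ∫ y in s, h y ∂μ ∈ Icc (0 : ℝ) 1 := by
  refine ⟨integral_nonneg h0, ?_⟩
  calc ∫ y in s, h y ∂μ ≤ ∫ y in s, (1 : ℝ) ∂μ :=
        integral_mono_of_nonneg (ae_of_all _ h0) (integrable_const _) (ae_of_all _ h1)
    _ ≤ 1 := by simp

theorem availProb_bounds (n : ℕ) :
    (∀ x, 0 ≤ availProb μ d n x) ∧ (∀ x, availProb μ d n x ≤ 1) ∧ Measurable (availProb μ d n) := by
  induction n with
  | zero => exact ⟨fun _ => zero_le_one, fun _ => le_rfl, measurable_const⟩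
  | succ n ih =>
    obtain ⟨h0, h1, hm⟩ := ih
    have hI (x) := setIntegral_mem_Icc (μ := μ) h0 h1 (Ioi x)
    refine ⟨fun x => pow_nonneg (by linarith [(hI x).2]) _,
      fun x => pow_le_one₀ (by linarith [(hI x).2]) (by linarith [(hI x).1]), ?_⟩
    refine (measurable_const.sub (Antitone.measurable fun x y hxy => ?_)).pow_const d
    have hint : Integrable (availProb μ d n) μ := .of_bound hm.aestronglyMeasurable 1
      (ae_of_all _ fun x => by rw [Real.norm_of_nonneg (h0 x)]; exact h1 x)
    exact setIntegral_mono_set hint.integrableOn (ae_of_all _ h0)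
      (Ioi_subset_Ioi hxy).eventuallyLE

theorem availProbLim_bounds (hd : 2 ≤ d) :
    (∀ x, 0 ≤ availProbLim μ d x) ∧ (∀ x, availProbLim μ d x ≤ 1) ∧
      Measurable (availProbLim μ d) := by
  have hd' : (1 : ℝ) ≤ (d : ℝ) - 1 := by
    have : (2 : ℝ) ≤ d := by exact_mod_cast hd
    linarith
  have hb (x) : 1 ≤ 1 + ((d : ℝ) - 1) * μ.real (Ioi x) := by
    have : 0 ≤ μ.real (Ioi x) := measureReal_nonneg
    nlinarith
  refine ⟨fun x => Real.rpow_nonneg (zero_le_one.trans (hb x)) _,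
    fun x => Real.rpow_le_one_of_one_le_of_nonpos (hb x) ?_, ?_⟩
  · have : 0 ≤ (d : ℝ) / ((d : ℝ) - 1) := by positivity
    linarith
  · exact ((measurable_real_Ioi.const_mul _).const_add _).pow_const _

/-- With `s = T(y)` and `q` for the base of the power, the equation becomes `q' = -q^d`, `q(0) = 1`,
solved by `q(s) = (1 + (d-1)s)^(-1/(d-1))`. -/
theorem availProbLim_eq [NullSingletonClass μ] (hd : 2 ≤ d) (x : ℝ) :
    availProbLim μ d x = (1 - ∫ y in Ioi x, availProbLim μ d y ∂μ) ^ d := by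
  have hd' : (1 : ℝ) ≤ (d : ℝ) - 1 := by
    have : (2 : ℝ) ≤ d := by exact_mod_cast hd
    linarith
  have hb {s : ℝ} (hs : 0 ≤ s) : 0 < 1 + ((d : ℝ) - 1) * s := by nlinarith
  have hT : 0 ≤ μ.real (Ioi x) := measureReal_nonneg
  have hint : ∫ y in Ioi x, availProbLim μ d y ∂μ =
      1 - (1 + ((d : ℝ) - 1) * μ.real (Ioi x)) ^ (-(1 / ((d : ℝ) - 1))) := by
    unfold availProbLim
    rw [setIntegral_comp_real_Ioi
      (φ := fun s => (1 + ((d : ℝ) - 1) * s) ^ (-((d : ℝ) / ((d : ℝ) - 1)))) (by fun_prop),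
      intervalIntegral.integral_eq_sub_of_hasDerivAt
        (f := fun s => - (1 + ((d : ℝ) - 1) * s) ^ (-(1 / ((d : ℝ) - 1))))]
    · simp; ring
    · intro s hs
      rw [uIcc_of_le hT] at hs
      have h1 : HasDerivAt (fun s : ℝ => 1 + ((d : ℝ) - 1) * s) ((d : ℝ) - 1) s := by
        simpa using ((hasDerivAt_id s).const_mul ((d : ℝ) - 1)).const_add 1
      have h2 := (h1.rpow_const (p := -(1 / ((d : ℝ) - 1))) (Or.inl (hb hs.1).ne')).neg
      have he : -(1 / ((d : ℝ) - 1)) - 1 = -((d : ℝ) / ((d : ℝ) - 1)) := by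
        field_simp; ring
      rw [he] at h2
      refine (h2.congr_deriv ?_)
      field_simp
    · refine ContinuousOn.intervalIntegrable fun s hs => ?_
      rw [uIcc_of_le hT] at hs
      exact ContinuousAt.continuousWithinAt
        (ContinuousAt.rpow_const (by fun_prop) (Or.inl (hb hs.1).ne'))
  rw [hint, sub_sub_cancel, ← Real.rpow_natCast, ← Real.rpow_mul (hb hT).le, availProbLim]
  congr 1
  ring

theorem abs_pow_sub_pow_le_mul {a b : ℝ} (ha : a ∈ Icc (0 : ℝ) 1) (hb : b ∈ Icc (0 : ℝ) 1)
    (n : ℕ) : |a ^ n - b ^ n| ≤ n * |a - b| := by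
  refine (abs_pow_sub_pow_le a b n).trans ?_
  have : max |a| |b| ^ (n - 1) ≤ 1 := by
    refine pow_le_one₀ (by positivity) (max_le ?_ ?_)
    · rw [abs_of_nonneg ha.1]; exact ha.2
    · rw [abs_of_nonneg hb.1]; exact hb.2
  calc _ ≤ |a - b| * n * 1 := by gcongr
    _ = _ := by ring

theorem integrable_of_mem_unit {h : ℝ → ℝ} (h0 : ∀ x, 0 ≤ h x) (h1 : ∀ x, h x ≤ 1)
    (hm : Measurable h) : Integrable h μ :=
  .of_bound hm.aestronglyMeasurable 1
    (ae_of_all _ fun x => by rw [Real.norm_of_nonneg (h0 x)]; exact h1 x)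

/-- The recursion reverses order, fixes the limit, and starts above it at `1`. -/
theorem availProbLim_between [NullSingletonClass μ] (hd : 2 ≤ d) (n : ℕ) :
    (Even n → ∀ x, availProbLim μ d x ≤ availProb μ d n x) ∧
    (Odd n → ∀ x, availProb μ d n x ≤ availProbLim μ d x) := by
  obtain ⟨l0, l1, lm⟩ := availProbLim_bounds (μ := μ) hd
  have lI := integrable_of_mem_unit (μ := μ) l0 l1 lm
  induction n with
  | zero => simpa [availProb] using l1
  | succ n ih =>
    obtain ⟨h0, h1, hm⟩ := availProb_bounds (μ := μ) (d := d) n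
    have hI := integrable_of_mem_unit (μ := μ) h0 h1 hm
    have hn : Even (n + 1) ↔ Odd n := by simp [Nat.even_add_one]
    have hn' : Odd (n + 1) ↔ Even n := by simp [Nat.odd_add_one]
    rw [hn, hn']
    constructor
    · intro h x
      rw [availProbLim_eq hd]
      have := setIntegral_mono hI.integrableOn lI.integrableOn (s := Ioi x) (ih.2 h)
      exact pow_le_pow_left₀ (by linarith [(setIntegral_mem_Icc (μ := μ) l0 l1 (Ioi x)).2])
        (by linarith) _
    · intro h x
      rw [availProbLim_eq hd]
      have := setIntegral_mono lI.integrableOn hI.integrableOn (s := Ioi x) (ih.1 h)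
      exact pow_le_pow_left₀ (by linarith [(setIntegral_mem_Icc (μ := μ) h0 h1 (Ioi x)).2])
        (by linarith) _

theorem setIntegral_tail_bound [NullSingletonClass μ] (n : ℕ) (x : ℝ) :
    d * ∫ y in Ioi x, (d * μ.real (Ioi y)) ^ n / n.factorial ∂μ =
      (d * μ.real (Ioi x)) ^ (n + 1) / (n + 1).factorial := by
  simp_rw [mul_pow, mul_div_right_comm]
  rw [integral_const_mul, setIntegral_tail_pow, Nat.factorial_succ]
  push_cast
  field_simp
  ring

theorem measurable_tail_bound (n : ℕ) :
    Measurable fun y => (d * μ.real (Ioi y)) ^ n / n.factorial :=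
  ((measurable_real_Ioi.const_mul _).pow_const _).div_const _

theorem integrable_tail_bound (n : ℕ) :
    Integrable (fun y => (d * μ.real (Ioi y)) ^ n / n.factorial) μ := by
  refine .of_bound (measurable_tail_bound n).aestronglyMeasurable ((d : ℝ) ^ n / n.factorial)
    (ae_of_all _ fun x => ?_)
  rw [Real.norm_of_nonneg (by positivity)]
  gcongr
  exact mul_le_of_le_one_right (by positivity) measureReal_le_one

/-- The power `d` is `d`-Lipschitz on `[0,1]`, so each level integrates the error over the tail and
multiplies it by `d`; `setIntegral_tail_bound` evaluates this iteration. -/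
theorem abs_availProb_sub_lim_le [NullSingletonClass μ] (hd : 2 ≤ d) (n : ℕ) (x : ℝ) :
    |availProb μ d n x - availProbLim μ d x| ≤ (d * μ.real (Ioi x)) ^ n / n.factorial := by
  obtain ⟨l0, l1, lm⟩ := availProbLim_bounds (μ := μ) hd
  have lI := integrable_of_mem_unit (μ := μ) l0 l1 lm
  induction n generalizing x with
  | zero =>
    simp only [availProb, pow_zero, Nat.factorial_zero, Nat.cast_one, div_one]
    rw [abs_le]
    constructor <;> linarith [l0 x, l1 x]
  | succ n ih =>
    obtain ⟨h0, h1, hm⟩ := availProb_bounds (μ := μ) (d := d) n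
    have hI := integrable_of_mem_unit (μ := μ) h0 h1 hm
    rw [availProbLim_eq hd, availProb, ← setIntegral_tail_bound]
    have ha := setIntegral_mem_Icc (μ := μ) h0 h1 (Ioi x)
    have hb := setIntegral_mem_Icc (μ := μ) l0 l1 (Ioi x)
    refine (abs_pow_sub_pow_le_mul ⟨by linarith [ha.2], by linarith [ha.1]⟩
      ⟨by linarith [hb.2], by linarith [hb.1]⟩ d).trans ?_
    gcongr
    rw [sub_sub_sub_cancel_left, ← integral_sub lI.integrableOn hI.integrableOn]
    refine (abs_integral_le_integral_abs).trans
      (integral_mono (lI.sub hI).abs.integrableOn (integrable_tail_bound n).integrableOn fun y => ?_)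
    simp only
    rw [abs_sub_comm]
    exact ih y

end Recursion

/-! ### Independence in product measures -/

section Product

open Set

variable {E : Type*} [Fintype E] {μ : Measure ℝ} [IsProbabilityMeasure μ]

/-- Choosing the coordinates in `S` from one sample and the others from an independent one gives
a sample of the product measure. -/
theorem measurePreserving_piecewise (S : Set E) [∀ i, Decidable (i ∈ S)] :
    MeasurePreserving (fun p : (E → ℝ) × (E → ℝ) => S.piecewise p.1 p.2)
      ((Measure.pi fun _ : E => μ).prod (Measure.pi fun _ : E => μ))
      (Measure.pi fun _ : E => μ) := by
  have hm : Measurable fun p : (E → ℝ) × (E → ℝ) => S.piecewise p.1 p.2 := by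
    refine measurable_pi_lambda _ fun i => ?_
    by_cases hi : i ∈ S
    · simp only [piecewise_eq_of_mem _ _ _ hi]; fun_prop
    · simp only [piecewise_eq_of_notMem _ _ _ hi]; fun_prop
  refine ⟨hm, (Measure.pi_eq fun s hs => ?_).symm⟩
  have hpre : (fun p : (E → ℝ) × (E → ℝ) => S.piecewise p.1 p.2) ⁻¹' (univ.pi s) =
      (univ.pi fun i => if i ∈ S then s i else univ) ×ˢ
        (univ.pi fun i => if i ∈ S then univ else s i) := by
    ext p
    simp only [mem_preimage, mem_pi, mem_univ, true_imp_iff, mem_prod, ← forall_and]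
    refine forall_congr' fun i => ?_
    by_cases hi : i ∈ S <;> simp [hi]
  rw [Measure.map_apply hm (MeasurableSet.univ_pi hs), hpre, Measure.prod_prod, Measure.pi_pi,
    Measure.pi_pi, ← Finset.prod_mul_distrib]
  refine Finset.prod_congr rfl fun i _ => ?_
  by_cases hi : i ∈ S <;> simp [hi]

/-- The event `A` depends on the coordinates in `S` only. -/
def EventDependsOn (A : Set (E → ℝ)) (S : Set E) : Prop :=
  ∀ w w' : E → ℝ, (∀ i ∈ S, w i = w' i) → (w ∈ A ↔ w' ∈ A)

/-- On a sample mixed from two independent ones along `S`, `A` sees only the first and `B` only the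
second, so the intersection becomes a rectangle. -/
theorem measureReal_inter_of_dependsOn {A B : Set (E → ℝ)} {S T : Set E} (hA : MeasurableSet A)
    (hB : MeasurableSet B) (hAS : EventDependsOn A S) (hBT : EventDependsOn B T)
    (hST : Disjoint S T) :
    (Measure.pi fun _ : E => μ).real (A ∩ B) =
      (Measure.pi fun _ : E => μ).real A * (Measure.pi fun _ : E => μ).real B := by
  classical
  rw [← (measurePreserving_piecewise (μ := μ) S).measureReal_preimage
    (hA.inter hB).nullMeasurableSet, ← measureReal_prod_prod]
  congr 1
  ext p
  simp only [mem_preimage, mem_inter_iff, mem_prod]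
  refine and_congr (hAS _ _ fun i hi => ?_) (hBT _ _ fun i hi => ?_)
  · simp [hi]
  · simp [Set.disjoint_right.1 hST hi]

theorem measureReal_biInter_of_dependsOn {ι : Type*} (s : Finset ι) {A : ι → Set (E → ℝ)}
    {S : ι → Set E} (hA : ∀ i ∈ s, MeasurableSet (A i))
    (hAS : ∀ i ∈ s, EventDependsOn (A i) (S i))
    (hS : ∀ i ∈ s, ∀ j ∈ s, i ≠ j → Disjoint (S i) (S j)) :
    (Measure.pi fun _ : E => μ).real (⋂ i ∈ s, A i) =
      ∏ i ∈ s, (Measure.pi fun _ : E => μ).real (A i) := by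
  classical
  induction s using Finset.induction_on with
  | empty => simp
  | insert a s ha ih =>
    rw [Finset.set_biInter_insert, Finset.prod_insert ha,
      ← ih (fun i hi => hA i (Finset.mem_insert_of_mem hi))
        (fun i hi => hAS i (Finset.mem_insert_of_mem hi))
        (fun i hi j hj => hS i (Finset.mem_insert_of_mem hi) j (Finset.mem_insert_of_mem hj))]
    refine measureReal_inter_of_dependsOn (T := ⋃ i ∈ s, S i) (hA a (Finset.mem_insert_self _ _))
      (Finset.measurableSet_biInter s fun i hi => hA i (Finset.mem_insert_of_mem hi))
      (hAS a (Finset.mem_insert_self _ _)) ?_ ?_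
    · intro w w' hw
      simp only [mem_iInter]
      refine forall_congr' fun i => forall_congr' fun hi =>
        hAS i (Finset.mem_insert_of_mem hi) _ _ fun j hj => hw j ?_
      simp only [mem_iUnion]
      exact ⟨i, hi, hj⟩
    · simp only [disjoint_iUnion_right]
      intro i hi
      refine hS a (Finset.mem_insert_self _ _) i (Finset.mem_insert_of_mem hi) ?_
      rintro rfl
      exact ha hi

/-- Integration over an event that involves the coordinate `e` both directly and through a
parameter: the coordinate can be integrated last. -/
theorem setIntegral_eval_eq {φ : ℝ → ℝ} (hφ : Integrable φ μ) (e : E)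
    {Q : ℝ → (E → ℝ) → Prop} (hQ : MeasurableSet {p : ℝ × (E → ℝ) | Q p.1 p.2})
    (hdep : ∀ x w w', (∀ i, i ≠ e → w i = w' i) → (Q x w ↔ Q x w')) :
    ∫ w in {w | Q (w e) w}, φ (w e) ∂(Measure.pi fun _ : E => μ) =
      ∫ x, φ x * (Measure.pi fun _ : E => μ).real {w | Q x w} ∂μ := by
  classical
  set π := Measure.pi fun _ : E => μ with hπ
  have hev : MeasurePreserving (Function.eval e) π μ := measurePreserving_eval _ e
  have hpw := measurePreserving_piecewise (μ := μ) ({e} : Set E)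
  have hms : MeasurableSet {w : E → ℝ | Q (w e) w} :=
    (show Measurable fun w : E → ℝ => (w e, w) by fun_prop) hQ
  have hmx (x) : MeasurableSet {w : E → ℝ | Q x w} :=
    (show Measurable fun w : E → ℝ => (x, w) by fun_prop) hQ
  set F : ℝ × (E → ℝ) → ℝ := {p | Q p.1 p.2}.indicator fun p => φ p.1 with hF
  have hFi : Integrable F (μ.prod π) := (hφ.comp_fst π).indicator hQ
  have hprod : MeasurePreserving (Prod.map (Function.eval e) id) (π.prod π) (μ.prod π) :=
    hev.prod (.id π)
  have h1 : ∫ w in {w | Q (w e) w}, φ (w e) ∂π = ∫ w, F (w e, w) ∂π := by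
    rw [← integral_indicator hms]
    rfl
  -- The mixed sample takes coordinate `e` from the first copy and all others from the second. As `Q
  -- x` ignores coordinate `e`, the second copy can stand in for the mixture there.
  have h2 : ∀ p : (E → ℝ) × (E → ℝ),
      F (({e} : Set E).piecewise p.1 p.2 e, ({e} : Set E).piecewise p.1 p.2) =
        F (Prod.map (Function.eval e) id p) := by
    intro p
    have h3 : Q (p.1 e) (({e} : Set E).piecewise p.1 p.2) ↔ Q (p.1 e) p.2 :=
      hdep _ _ _ fun i hi => by simp [hi]
    simp only [hF, indicator, mem_ofPred_eq, Prod.map, Function.eval, id,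
      piecewise_eq_of_mem _ _ _ (mem_singleton e), h3]
  have hFm : AEStronglyMeasurable (fun w : E → ℝ => F (w e, w)) π := by
    have : (fun w : E → ℝ => F (w e, w)) = {w | Q (w e) w}.indicator fun w => φ (w e) := rfl
    rw [this]
    exact (hφ.aestronglyMeasurable.comp_measurePreserving hev).indicator hms
  rw [← hπ] at hpw
  have h3 : ∫ w, F (w e, w) ∂π = ∫ p, F (Prod.map (Function.eval e) id p) ∂(π.prod π) := by
    conv_lhs => rw [← hpw.map_eq]
    rw [integral_map hpw.measurable.aemeasurable (by rw [hpw.map_eq]; exact hFm)]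
    simp_rw [h2]
  have h4 : ∫ p, F (Prod.map (Function.eval e) id p) ∂(π.prod π) = ∫ q, F q ∂(μ.prod π) := by
    conv_rhs => rw [← hprod.map_eq]
    rw [integral_map hprod.measurable.aemeasurable
      (by rw [hprod.map_eq]; exact hFi.aestronglyMeasurable)]
  rw [h1, h3, h4, integral_prod _ hFi]
  refine integral_congr_ae (ae_of_all _ fun x => ?_)
  have : (fun w => F (x, w)) = {w | Q x w}.indicator fun _ => φ x := rfl
  simp only [this]
  rw [integral_indicator (hmx x), setIntegral_const, smul_eq_mul, mul_comm]

theorem measureReal_eval_gt (e : E) {Q : ℝ → (E → ℝ) → Prop}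
    (hQ : MeasurableSet {p : ℝ × (E → ℝ) | Q p.1 p.2})
    (hdep : ∀ x w w', (∀ i, i ≠ e → w i = w' i) → (Q x w ↔ Q x w')) (x : ℝ) :
    (Measure.pi fun _ : E => μ).real {w | x < w e ∧ Q (w e) w} =
      ∫ y in Ioi x, (Measure.pi fun _ : E => μ).real {w | Q y w} ∂μ := by
  have hms : MeasurableSet {w : E → ℝ | Q (w e) w} :=
    (show Measurable fun w : E → ℝ => (w e, w) by fun_prop) hQ
  have h := setIntegral_eval_eq (μ := μ) (φ := (Ioi x).indicator 1)
    ((integrable_const (1 : ℝ)).indicator measurableSet_Ioi) e hQ hdep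
  have hr : ∀ y, (Ioi x).indicator (1 : ℝ → ℝ) y * (Measure.pi fun _ : E => μ).real {w | Q y w} =
      (Ioi x).indicator (fun y => (Measure.pi fun _ : E => μ).real {w | Q y w}) y := by
    intro y
    by_cases hy : y ∈ Ioi x <;> simp [hy]
  simp_rw [hr] at h
  rw [integral_indicator measurableSet_Ioi] at h
  rw [← h]
  have h5 : (fun w : E → ℝ => (Ioi x).indicator (1 : ℝ → ℝ) (w e)) =
      ((fun w : E → ℝ => w e) ⁻¹' Ioi x).indicator 1 := rfl
  rw [h5, integral_indicator (measurable_pi_apply e measurableSet_Ioi),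
    Measure.restrict_restrict (measurable_pi_apply e measurableSet_Ioi)]
  simp only [Pi.one_apply, setIntegral_const, smul_eq_mul, mul_one]
  rfl

end Product

/-! ### Probabilities of availability and of increasing paths -/

section Weights

open Set

variable {V : Type*} {G : SimpleGraph V}

/-- The extension by zero of a weighting of the edges. -/
noncomputable def extendWeights (w : G.edgeSet → ℝ) (e : Sym2 V) : ℝ :=
  open Classical in if h : e ∈ G.edgeSet then w ⟨e, h⟩ else 0

theorem extendWeights_apply (w : G.edgeSet → ℝ) (e : Sym2 V) (h : e ∈ G.edgeSet) :
    extendWeights w e = w ⟨e, h⟩ := dif_pos h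

theorem measurable_extendWeights (e : Sym2 V) :
    Measurable fun w : G.edgeSet → ℝ => extendWeights w e := by
  unfold extendWeights
  split_ifs <;> fun_prop

theorem measurableSet_avail [Finite V] {α : Type*} [MeasurableSpace α] {w : α → Sym2 V → ℝ}
    (hw : ∀ e, Measurable fun a => w a e) : ∀ (n : ℕ) (u v : V) {X : α → ℝ}, Measurable X →
    MeasurableSet {a | Avail G (w a) n u v (X a)}
  | 0, _, _, _, _ => MeasurableSet.univ
  | n + 1, u, v, X, hX => by
    have : {a | Avail G (w a) (n + 1) u v (X a)} = ⋂ c, ⋂ (_ : G.Adj v c), ⋂ (_ : c ≠ u),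
        ({a | X a < w a s(v, c)} ∩ {a | Avail G (w a) n v c (w a s(v, c))})ᶜ := by
      ext a
      simp only [mem_ofPred_eq, Avail, mem_iInter, mem_compl_iff, mem_inter_iff, not_and]
    rw [this]
    have : Countable V := Finite.to_countable
    exact .iInter fun c => .iInter fun _ => .iInter fun _ =>
      ((measurableSet_lt hX (hw _)).inter (measurableSet_avail hw n v c (hw _))).compl

theorem measurableSet_chain [Finite V] {α : Type*} [MeasurableSpace α] {w : α → Sym2 V → ℝ}
    (hw : ∀ e, Measurable fun a => w a e) : ∀ (n : ℕ) (u v : V) {X : α → ℝ}, Measurable X →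
    MeasurableSet {a | Chain G (w a) n u v (X a)}
  | 0, _, _, _, _ => MeasurableSet.univ
  | n + 1, u, v, X, hX => by
    have : {a | Chain G (w a) (n + 1) u v (X a)} = ⋃ c, ⋃ (_ : G.Adj v c), ⋃ (_ : c ≠ u),
        ({a | X a < w a s(v, c)} ∩ {a | Chain G (w a) n v c (w a s(v, c))}) := by
      ext a
      simp only [mem_ofPred_eq, Chain, mem_iUnion, mem_inter_iff, exists_prop]
    rw [this]
    have : Countable V := Finite.to_countable
    exact .iUnion fun c => .iUnion fun _ => .iUnion fun _ =>
      ((measurableSet_lt hX (hw _)).inter (measurableSet_chain hw n v c (hw _)))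

theorem extendWeights_congr {w w' : G.edgeSet → ℝ} {S : Set (Sym2 V)}
    (h : ∀ i : G.edgeSet, (i : Sym2 V) ∈ S → w i = w' i) :
    ∀ e ∈ S, extendWeights w e = extendWeights w' e := by
  intro e he
  unfold extendWeights
  split_ifs with h1
  · exact h ⟨e, h1⟩ he
  · rfl

theorem measurableSet_avail_prod [Finite V] (n : ℕ) (u v : V) :
    MeasurableSet {p : ℝ × (G.edgeSet → ℝ) | Avail G (extendWeights p.2) n u v p.1} :=
  measurableSet_avail (fun e => (measurable_extendWeights e).comp measurable_snd) n u v
    measurable_fst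

theorem measurableSet_chain_prod [Finite V] (n : ℕ) (u v : V) :
    MeasurableSet {p : ℝ × (G.edgeSet → ℝ) | Chain G (extendWeights p.2) n u v p.1} :=
  measurableSet_chain (fun e => (measurable_extendWeights e).comp measurable_snd) n u v
    measurable_fst

theorem avail_extend_congr {n : ℕ} {u v : V} (h : G.Adj u v)
    (hg : ((n + 1 : ℕ) : ℕ∞) < G.egirth) (x : ℝ) (w w' : G.edgeSet → ℝ)
    (hw : ∀ i, i ≠ ⟨s(u, v), h⟩ → w i = w' i) :
    Avail G (extendWeights w) n u v x ↔ Avail G (extendWeights w') n u v x := by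
  refine avail_congr n u v x (extendWeights_congr fun i hi => hw i ?_)
  rintro rfl
  exact edge_notMem_explored h hg hi

theorem chain_extend_congr {n : ℕ} {u v : V} (h : G.Adj u v)
    (hg : ((n + 1 : ℕ) : ℕ∞) < G.egirth) (x : ℝ) (w w' : G.edgeSet → ℝ)
    (hw : ∀ i, i ≠ ⟨s(u, v), h⟩ → w i = w' i) :
    Chain G (extendWeights w) n u v x ↔ Chain G (extendWeights w') n u v x := by
  refine chain_congr n u v x (extendWeights_congr fun i hi => hw i ?_)
  rintro rfl
  exact edge_notMem_explored h hg hi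

variable [Finite V] [Fintype G.edgeSet] {μ : Measure ℝ} [IsProbabilityMeasure μ] {d : ℕ}

/-- While the exploration sees a tree, availability has the probability that it has on the tree. -/
theorem measureReal_avail (hdeg : ∀ v, (G.neighborSet v).ncard = d + 1) (n : ℕ) {u v : V}
    (h : G.Adj u v) (hg : ((2 * n : ℕ) : ℕ∞) < G.egirth) (x : ℝ) :
    (Measure.pi fun _ : G.edgeSet => μ).real {w | Avail G (extendWeights w) n u v x} =
      availProb μ d n x := by
  classical
  induction n generalizing u v x with
  | zero => simp [Avail, availProb]
  | succ n ih =>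
    have := Fintype.ofFinite V
    have hg0 : ((2 * n : ℕ) : ℕ∞) < G.egirth := lt_of_le_of_lt (by norm_cast; omega) hg
    have hg1 : ((n + 1 : ℕ) : ℕ∞) < G.egirth := lt_of_le_of_lt (by norm_cast; omega) hg
    set s : Finset V := (G.neighborFinset v).erase u with hs
    have hsmem (c) : c ∈ s ↔ c ≠ u ∧ G.Adj v c := by simp [hs]
    have hcard : s.card = d := by
      rw [hs, Finset.card_erase_of_mem (by simpa using h.symm), ← Set.ncard_coe_finset,
        SimpleGraph.coe_neighborFinset, hdeg]
      rfl
    set D : V → Set (G.edgeSet → ℝ) := fun c =>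
      {w | x < extendWeights w s(v, c) ∧
        Avail G (extendWeights w) n v c (extendWeights w s(v, c))} with hD
    have hDm (c) : MeasurableSet (D c) :=
      (measurableSet_lt measurable_const (measurable_extendWeights _)).inter
        (measurableSet_avail measurable_extendWeights n v c (measurable_extendWeights _))
    -- The far end is available iff none of the `d` branch events `D c` occurs; these depend on
    -- disjoint edge sets, so the probabilities multiply.
    have hset : {w : G.edgeSet → ℝ | Avail G (extendWeights w) (n + 1) u v x} =
        ⋂ c ∈ s, (D c)ᶜ := by
      ext w
      simp only [mem_ofPred_eq, Avail, mem_iInter, hsmem, hD, mem_compl_iff, not_and]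
      constructor
      · intro h c hc
        exact h c hc.2 hc.1
      · intro h c h1 h2
        exact h c ⟨h2, h1⟩
    rw [hset, measureReal_biInter_of_dependsOn s
      (S := fun c => Subtype.val ⁻¹' (insert s(v, c) (Explored G n v c)))
      (fun c _ => (hDm c).compl)]
    · have hpow : availProb μ d (n + 1) x =
          ∏ _c ∈ s, (1 - ∫ y in Ioi x, availProb μ d n y ∂μ) := by
        rw [Finset.prod_const, hcard, availProb]
      rw [hpow]
      refine Finset.prod_congr rfl fun c hc => ?_
      rw [probReal_compl_eq_one_sub (hDm c)]
      congr 1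
      have hvc := ((hsmem c).1 hc).2
      have hDe : D c = {w | x < w ⟨s(v, c), hvc⟩ ∧
          Avail G (extendWeights w) n v c (w ⟨s(v, c), hvc⟩)} := by
        simp only [hD, extendWeights_apply _ _ (show s(v, c) ∈ G.edgeSet from hvc)]
      rw [hDe]
      refine (measureReal_eval_gt (μ := μ) (⟨s(v, c), hvc⟩ : G.edgeSet)
        (measurableSet_avail_prod n v c) (avail_extend_congr hvc hg1) x).trans ?_
      exact setIntegral_congr_fun measurableSet_Ioi fun y _ => ih hvc hg0 y
    · intro c hc w w' hw
      have := extendWeights_congr (S := insert s(v, c) (Explored G n v c)) hw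
      simp only [hD, mem_compl_iff, mem_ofPred_eq]
      rw [this _ (mem_insert _ _), avail_congr n v c _ fun e he => this e (mem_insert_of_mem _ he)]
    · intro c hc c' hc' hne
      exact (disjoint_explored_branches ((hsmem c).1 hc).2 ((hsmem c').1 hc').2 hne hg).preimage _

/-- Increasing continuations of a given length are unlikely. -/
theorem measureReal_chain_le [NullSingletonClass μ] (hdeg : ∀ v, (G.neighborSet v).ncard = d + 1)
    (n : ℕ) {u v : V} (h : G.Adj u v) (hg : ((n : ℕ) : ℕ∞) < G.egirth) (x : ℝ) :
    (Measure.pi fun _ : G.edgeSet => μ).real {w | Chain G (extendWeights w) n u v x} ≤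
      (d * μ.real (Ioi x)) ^ n / n.factorial := by
  classical
  induction n generalizing u v x with
  | zero => simp [Chain]
  | succ n ih =>
    have := Fintype.ofFinite V
    have hg0 : ((n : ℕ) : ℕ∞) < G.egirth := lt_of_le_of_lt (by norm_cast; omega) hg
    set s : Finset V := (G.neighborFinset v).erase u with hs
    have hsmem (c) : c ∈ s ↔ c ≠ u ∧ G.Adj v c := by simp [hs]
    have hcard : s.card = d := by
      rw [hs, Finset.card_erase_of_mem (by simpa using h.symm), ← Set.ncard_coe_finset,
        SimpleGraph.coe_neighborFinset, hdeg]
      rfl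
    set D : V → Set (G.edgeSet → ℝ) := fun c =>
      {w | x < extendWeights w s(v, c) ∧
        Chain G (extendWeights w) n v c (extendWeights w s(v, c))} with hD
    have hset : {w : G.edgeSet → ℝ | Chain G (extendWeights w) (n + 1) u v x} = ⋃ c ∈ s, D c := by
      ext w
      simp only [mem_ofPred_eq, Chain, mem_iUnion, hsmem, hD]
      constructor
      · rintro ⟨c, h1, h2, h3⟩
        exact ⟨c, ⟨h2, h1⟩, h3⟩
      · rintro ⟨c, ⟨h2, h1⟩, h3⟩
        exact ⟨c, h1, h2, h3⟩
    rw [hset, ← setIntegral_tail_bound]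
    -- A union bound suffices here, so branches need not be disjoint: girth serves only to keep the
    -- edge `vc` out of the exploration beyond it.
    refine (measureReal_biUnion_finset_le _ _).trans ((Finset.sum_le_card_nsmul s _ _ ?_).trans
      (by rw [hcard, nsmul_eq_mul]))
    intro c hc
    have hvc := ((hsmem c).1 hc).2
    have hDe : D c = {w | x < w ⟨s(v, c), hvc⟩ ∧
        Chain G (extendWeights w) n v c (w ⟨s(v, c), hvc⟩)} := by
      simp only [hD, extendWeights_apply _ _ (show s(v, c) ∈ G.edgeSet from hvc)]
    rw [hDe]
    refine (measureReal_eval_gt (μ := μ) (⟨s(v, c), hvc⟩ : G.edgeSet)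
      (measurableSet_chain_prod n v c) (chain_extend_congr hvc hg) x).trans_le ?_
    exact integral_mono_of_nonneg (ae_of_all _ fun _ => measureReal_nonneg)
      (integrable_tail_bound n).integrableOn (ae_of_all _ fun y => ih hvc hg0 y)

end Weights

/-! ### Regular graphs of large girth -/

section Existence

/-- Words over `Fin r` of length at most `n` without two equal consecutive letters. -/
abbrev ReducedWord (r n : ℕ) : Type :=
  {l : List (Fin r) // l.length ≤ n ∧ l.IsChain (· ≠ ·)}

variable {r n : ℕ}

instance : Finite (ReducedWord r n) :=
  Set.Finite.subset (List.finite_length_le (Fin r) n) (fun _ h => h.1)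

/-- Multiplication by the letter `c`, where this does not lead to a word that is too long. -/
def ReducedWord.letterMul (c : Fin r) (l : ReducedWord r n) : ReducedWord r n :=
  match l with
  | ⟨[], h⟩ => if hn : 1 ≤ n then ⟨[c], by simpa using hn, by simp⟩ else ⟨[], h⟩
  | ⟨a :: l, h⟩ =>
    if hac : a = c then ⟨l, by simpa using (Nat.le_of_succ_le h.1), h.2.tail⟩
    else if hn : l.length + 2 ≤ n then
      ⟨c :: a :: l, hn, List.isChain_cons_cons.2 ⟨fun h => hac h.symm, h.2⟩⟩
    else ⟨a :: l, h⟩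

theorem ReducedWord.letterMul_involutive (c : Fin r) :
    Function.Involutive (ReducedWord.letterMul (n := n) c) := by
  rintro ⟨l, hl⟩
  rcases l with _ | ⟨a, l⟩
  · by_cases hn : 1 ≤ n <;> simp [letterMul, hn]
  · by_cases hac : a = c
    · subst hac
      rcases l with _ | ⟨b, l⟩
      · have : 1 ≤ n := by simpa using hl.1
        simp [letterMul, this]
      · have h1 : l.length + 2 ≤ n := hl.1
        have h2 : b ≠ a := fun h => (List.isChain_cons_cons.1 hl.2).1 h.symm
        simp [letterMul, h1, h2]
    · by_cases hn : l.length + 2 ≤ n <;> simp [letterMul, hac, hn]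

/-- Multiplication by a letter as a permutation of the reduced words of bounded length. -/
def letterPerm (n : ℕ) (c : Fin r) : Equiv.Perm (ReducedWord r n) :=
  (ReducedWord.letterMul_involutive c).toPerm

theorem letterPerm_mul_self (c : Fin r) : letterPerm n c * letterPerm n c = 1 := by
  ext l : 1
  exact ReducedWord.letterMul_involutive c l

/-- The empty word. -/
def ReducedWord.empty (r n : ℕ) : ReducedWord r n := ⟨[], by simp, by simp⟩

theorem letterPerm_cons (c : Fin r) (l : ReducedWord r n) (h1 : l.1.length < n)
    (h2 : ∀ a ∈ l.1.head?, a ≠ c) : (letterPerm n c l).1 = c :: l.1 := by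
  obtain ⟨l, hl⟩ := l
  change (ReducedWord.letterMul c ⟨l, hl⟩).1 = _
  rcases l with _ | ⟨a, l⟩
  · have : 1 ≤ n := h1
    simp [ReducedWord.letterMul, this]
  · have h3 : a ≠ c := h2 a (by simp)
    have h4 : l.length + 2 ≤ n := h1
    simp [ReducedWord.letterMul, h3, h4]

theorem letterPerm_injective (hn : 1 ≤ n) : Function.Injective (letterPerm (r := r) n) := by
  intro c c' h
  have h1 := letterPerm_cons c (ReducedWord.empty r n) hn (by simp [ReducedWord.empty])
  have h2 := letterPerm_cons c' (ReducedWord.empty r n) hn (by simp [ReducedWord.empty])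
  rw [h, h2] at h1
  exact (List.cons.inj h1).1.symm

/-- The Cayley graph of the permutation group of the reduced words of length at most `n`, with
respect to the multiplications by letters. -/
def wordGraph (r n : ℕ) (hn : 1 ≤ n) : SimpleGraph (Equiv.Perm (ReducedWord r n)) where
  Adj σ τ := ∃ c, τ = σ * letterPerm n c
  symm := ⟨by
    rintro σ τ ⟨c, rfl⟩
    exact ⟨c, by rw [mul_assoc, letterPerm_mul_self, mul_one]⟩⟩
  loopless := ⟨by
    rintro σ ⟨c, hc⟩
    have h1 := letterPerm_cons c (ReducedWord.empty r n) hn (by simp [ReducedWord.empty])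
    rw [left_eq_mul.1 hc, Equiv.Perm.one_apply] at h1
    simp [ReducedWord.empty] at h1⟩

theorem wordGraph_neighborSet (hn : 1 ≤ n) (σ : Equiv.Perm (ReducedWord r n)) :
    (wordGraph r n hn).neighborSet σ = Set.range fun c => σ * letterPerm n c := by
  ext τ
  simp [wordGraph, SimpleGraph.mem_neighborSet, eq_comm]

/-- `σ⁻¹ * τ` is the product of the letters along the trail, and acting on the empty word it
prepends them from the last to the first. A cancellation would mean crossing the same edge twice in
a row; the claim about the head letter lets the induction rule this out. -/
theorem wordGraph_isTrail (hn : 1 ≤ n) {σ τ : Equiv.Perm (ReducedWord r n)}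
    (p : (wordGraph r n hn).Walk σ τ) (hp : p.IsTrail) (hl : p.length ≤ n) :
    ((σ⁻¹ * τ) (ReducedWord.empty r n)).1.length = p.length ∧
      ∀ a ∈ ((σ⁻¹ * τ) (ReducedWord.empty r n)).1.head?, s(σ, σ * letterPerm n a) ∈ p.edges := by
  induction p with
  | nil => rw [inv_mul_cancel, Equiv.Perm.one_apply]; simp [ReducedWord.empty]
  | @cons σ ρ τ h p ih =>
    rw [SimpleGraph.Walk.isTrail_cons] at hp
    rw [SimpleGraph.Walk.length_cons] at hl
    obtain ⟨h1, h2⟩ := ih hp.1 (by omega)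
    obtain ⟨c, rfl⟩ := h
    have h3 : σ⁻¹ * τ = letterPerm n c * ((σ * letterPerm n c)⁻¹ * τ) := by group
    have h4 := letterPerm_cons c (((σ * letterPerm n c)⁻¹ * τ) (ReducedWord.empty r n))
      (by omega) (by
        rintro a ha rfl
        have := h2 a ha
        rw [mul_assoc, letterPerm_mul_self, mul_one, Sym2.eq_swap] at this
        exact hp.2 this)
    rw [h3, Equiv.Perm.mul_apply, h4]
    constructor
    · rw [List.length_cons, h1]
      rfl
    · intro a ha
      simp only [List.head?_cons, Option.mem_def, Option.some.injEq] at ha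
      subst ha
      exact List.mem_cons_self

theorem le_egirth_wordGraph (hn : 1 ≤ n) : (n : ℕ∞) ≤ (wordGraph r n hn).egirth := by
  rw [SimpleGraph.le_egirth]
  intro σ p hp
  by_contra! hlt
  have hlt' : p.length < n := by exact_mod_cast hlt
  have h := (wordGraph_isTrail hn p hp.isTrail hlt'.le).1
  have := hp.three_le_length
  rw [inv_mul_cancel, Equiv.Perm.one_apply] at h
  simp [ReducedWord.empty] at h
  omega

theorem degree_eq_ncard {V : Type*} (G : SimpleGraph V) (v : V) [Fintype (G.neighborSet v)] :
    G.degree v = (G.neighborSet v).ncard := by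
  rw [← SimpleGraph.card_neighborSet_eq_degree, ← Nat.card_eq_fintype_card, Nat.card_coe_set_eq]

/-- There are finite `r`-regular graphs of arbitrarily large girth. -/
theorem exists_regularGirth (g r : ℕ) : ∃ (V : Type u) (_ : Finite V) (_ : Nonempty V)
    (G : SimpleGraph V), RegularGirth G g r := by
  -- Words of length up to `g + 1` keep the bound positive even for `g = 0`.
  have hn : 1 ≤ g + 1 := by omega
  let e : ULift.{u} (Equiv.Perm (ReducedWord r (g + 1))) ≃ Equiv.Perm (ReducedWord r (g + 1)) :=
    Equiv.ulift
  refine ⟨ULift.{u} (Equiv.Perm (ReducedWord r (g + 1))), inferInstance, inferInstance,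
    (wordGraph r (g + 1) hn).comap e, ⟨fun v => Fintype.ofFinite _, fun v => ?_⟩, ?_⟩
  · rw [degree_eq_ncard]
    have h1 : ((wordGraph r (g + 1) hn).comap e).neighborSet v =
        e ⁻¹' (wordGraph r (g + 1) hn).neighborSet (e v) := rfl
    rw [h1, Set.ncard_preimage_of_injective_subset_range e.injective (by simp),
      wordGraph_neighborSet, ← Nat.card_coe_set_eq]
    exact (Nat.card_range_of_injective
      ((mul_right_injective (e v)).comp (letterPerm_injective hn))).trans (Nat.card_fin r)
  · rw [(SimpleGraph.Iso.comap e _).egirth_eq]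
    exact le_trans (by exact_mod_cast Nat.le_succ g) (le_egirth_wordGraph hn)

end Existence

/-! ### The contribution of a single edge -/

section EdgeEstimate

open Set

variable {μ : Measure ℝ} {d : ℕ}

theorem integral_mul_le_of_le {p : ℝ → ℝ} {b : ℝ} (hid : Integrable (fun x : ℝ => x) μ)
    (h0 : ∀ᵐ x ∂μ, 0 ≤ x) (hp0 : ∀ x, 0 ≤ p x) (hp : ∀ x, p x ≤ b) :
    ∫ x, x * p x ∂μ ≤ (∫ x, x ∂μ) * b := by
  rw [← integral_mul_const]
  refine integral_mono_of_nonneg ?_ (hid.mul_const b) ?_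
  · filter_upwards [h0] with x hx using mul_nonneg hx (hp0 x)
  · filter_upwards [h0] with x hx using mul_le_mul_of_nonneg_left (hp x) hx

theorem integrable_mul_of_mem_unit {p : ℝ → ℝ} (hid : Integrable (fun x : ℝ => x) μ)
    (hp0 : ∀ x, 0 ≤ p x) (hp : ∀ x, p x ≤ 1) (hm : Measurable p) :
    Integrable (fun x => x * p x) μ :=
  hid.mul_bdd (c := 1) hm.aestronglyMeasurable
    (ae_of_all _ fun x => by rw [Real.norm_of_nonneg (hp0 x)]; exact hp x)

variable [IsProbabilityMeasure μ]

theorem tail_bound_le (n : ℕ) (x : ℝ) :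
    (d * μ.real (Ioi x)) ^ n / n.factorial ≤ (d : ℝ) ^ n / n.factorial := by
  gcongr
  exact mul_le_of_le_one_right (by positivity) measureReal_le_one

theorem integral_mul_availProb_sq_bounds [NullSingletonClass μ] (hd : 2 ≤ d)
    (hid : Integrable (fun x : ℝ => x) μ) (h0 : ∀ᵐ x ∂μ, 0 ≤ x) (k : ℕ) :
    (Even k → ∫ x, x * availProbLim μ d x ^ 2 ∂μ ≤ ∫ x, x * availProb μ d k x ^ 2 ∂μ) ∧
    (Odd k → ∫ x, x * availProb μ d k x ^ 2 ∂μ ≤ ∫ x, x * availProbLim μ d x ^ 2 ∂μ) ∧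
    |(∫ x, x * availProb μ d k x ^ 2 ∂μ) - ∫ x, x * availProbLim μ d x ^ 2 ∂μ| ≤
      2 * ((∫ x, x ∂μ) * ((d : ℝ) ^ k / k.factorial)) := by
  obtain ⟨l0, l1, lm⟩ := availProbLim_bounds (μ := μ) hd
  obtain ⟨p0, p1, pm⟩ := availProb_bounds (μ := μ) (d := d) k
  have hl := integrable_mul_of_mem_unit hid (fun x => sq_nonneg (availProbLim μ d x))
    (fun x => pow_le_one₀ (l0 x) (l1 x)) (lm.pow_const 2)
  have hp := integrable_mul_of_mem_unit hid (fun x => sq_nonneg (availProb μ d k x))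
    (fun x => pow_le_one₀ (p0 x) (p1 x)) (pm.pow_const 2)
  obtain ⟨he, ho⟩ := availProbLim_between (μ := μ) hd k
  refine ⟨fun hk => integral_mono_ae hl hp ?_, fun hk => integral_mono_ae hp hl ?_, ?_⟩
  · filter_upwards [h0] with x hx
    exact mul_le_mul_of_nonneg_left (pow_le_pow_left₀ (l0 x) (he hk x) 2) hx
  · filter_upwards [h0] with x hx
    exact mul_le_mul_of_nonneg_left (pow_le_pow_left₀ (p0 x) (ho hk x) 2) hx
  · rw [← integral_sub hp hl, ← integral_mul_const, ← integral_const_mul]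
    rw [← Real.norm_eq_abs]
    refine norm_integral_le_of_norm_le ((hid.mul_const _).const_mul _) ?_
    filter_upwards [h0] with x hx
    rw [← mul_sub, Real.norm_eq_abs, abs_mul, abs_of_nonneg hx]
    have h1 := abs_pow_sub_pow_le_mul ⟨p0 x, p1 x⟩ ⟨l0 x, l1 x⟩ 2
    have h2 := (abs_availProb_sub_lim_le (μ := μ) hd k x).trans (tail_bound_le k x)
    push_cast at h1
    calc x * |availProb μ d k x ^ 2 - availProbLim μ d x ^ 2|
        ≤ x * (2 * ((d : ℝ) ^ k / k.factorial)) := by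
          refine mul_le_mul_of_nonneg_left (h1.trans ?_) hx
          gcongr
      _ = _ := by ring

variable {V : Type*} {G : SimpleGraph V}

/-- Both ends of the edge `e = s(u, v)` are available, as seen by exploring `n` levels. -/
def bothAvail (n : ℕ) (u v : V) (e : G.edgeSet) : Set (G.edgeSet → ℝ) :=
  {w | Avail G (extendWeights w) n u v (w e) ∧ Avail G (extendWeights w) n v u (w e)}

theorem measurableSet_bothAvail [Finite V] (n : ℕ) (u v : V) (e : G.edgeSet) :
    MeasurableSet (bothAvail n u v e) :=
  (measurableSet_avail measurable_extendWeights n u v (measurable_pi_apply e)).inter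
    (measurableSet_avail measurable_extendWeights n v u (measurable_pi_apply e))

variable [Fintype G.edgeSet]

theorem integrable_eval (hid : Integrable (fun x : ℝ => x) μ) (e : G.edgeSet) :
    Integrable (fun w : G.edgeSet → ℝ => w e) (Measure.pi fun _ : G.edgeSet => μ) :=
  (measurePreserving_eval (fun _ : G.edgeSet => μ) e).integrable_comp_of_integrable hid

theorem ae_eval_nonneg (h0 : ∀ᵐ x ∂μ, 0 ≤ x) (e : G.edgeSet) :
    ∀ᵐ w ∂(Measure.pi fun _ : G.edgeSet => μ), 0 ≤ w e :=
  (measurePreserving_eval (fun _ : G.edgeSet => μ) e).quasiMeasurePreserving.ae h0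

theorem ae_injective_weights [NullSingletonClass μ] :
    ∀ᵐ w ∂(Measure.pi fun _ : G.edgeSet => μ), Function.Injective w := by
  have h : ∀ e e' : G.edgeSet, e ≠ e' →
      ∀ᵐ w ∂(Measure.pi fun _ : G.edgeSet => μ), w e ≠ w e' := by
    intro e e' hne
    have hQ : MeasurableSet {p : ℝ × (G.edgeSet → ℝ) | p.1 = p.2 e'} :=
      measurableSet_eq_fun measurable_fst ((measurable_pi_apply e').comp measurable_snd)
    have h1 := setIntegral_eval_eq (μ := μ) (integrable_const (1 : ℝ)) e
      (Q := fun x w => x = w e') hQ (fun x w w' hw => by rw [hw e' hne.symm])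
    have h2 (x : ℝ) : (Measure.pi fun _ : G.edgeSet => μ).real {w | x = w e'} = 0 := by
      have h3 := (measurePreserving_eval (fun _ : G.edgeSet => μ) e').measureReal_preimage
        (measurableSet_singleton x).nullMeasurableSet
      have h4 : {w : G.edgeSet → ℝ | x = w e'} = (fun w : G.edgeSet → ℝ => w e') ⁻¹' {x} := by
        ext w; simp [eq_comm]
      rw [h4]
      refine h3.trans ?_
      simp [measureReal_def]
    simp only [h2, setIntegral_const, smul_eq_mul, mul_one, mul_zero, integral_zero] at h1
    rw [measureReal_eq_zero_iff] at h1
    rw [ae_iff]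
    simpa using h1
  have h' : ∀ᵐ w ∂(Measure.pi fun _ : G.edgeSet => μ), ∀ e e', e ≠ e' → w e ≠ w e' :=
    ae_all_iff.2 fun e => ae_all_iff.2 fun e' => by
      by_cases hne : e = e'
      · exact ae_of_all _ fun w hw => absurd hne hw
      · filter_upwards [h e e' hne] with w hw _ using hw
  filter_upwards [h'] with w hw e e' hee
  by_contra hne
  exact hw e e' hne hee

variable [Finite V]

/-- The edge lies in neither exploration and the two sides are disjoint. So for fixed weight `x`
they are independent, which gives the square, and `x` is integrated last. -/
theorem setIntegral_bothAvail (hdeg : ∀ v, (G.neighborSet v).ncard = d + 1)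
    (hid : Integrable (fun x : ℝ => x) μ) (k : ℕ) {u v : V} (h : G.Adj u v)
    (hg : ((2 * k + 1 : ℕ) : ℕ∞) < G.egirth) (e : G.edgeSet) (he : (e : Sym2 V) = s(u, v)) :
    ∫ w in bothAvail k u v e, w e ∂(Measure.pi fun _ : G.edgeSet => μ) =
      ∫ x, x * availProb μ d k x ^ 2 ∂μ := by
  have hg1 : ((k + 1 : ℕ) : ℕ∞) < G.egirth := lt_of_le_of_lt (by norm_cast; omega) hg
  have hg2 : ((2 * k : ℕ) : ℕ∞) < G.egirth := lt_of_le_of_lt (by norm_cast; omega) hg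
  have he1 : e = ⟨s(u, v), h⟩ := Subtype.ext he
  have he2 : e = ⟨s(v, u), h.symm⟩ := Subtype.ext (he.trans Sym2.eq_swap)
  have hm := (measurableSet_avail_prod (G := G) k u v).inter (measurableSet_avail_prod k v u)
  have hQ := setIntegral_eval_eq hid e (Q := fun x w => Avail G (extendWeights w) k u v x ∧
    Avail G (extendWeights w) k v u x) hm (fun x w w' hw => and_congr
      (avail_extend_congr h hg1 x w w' (by rwa [he1] at hw))
      (avail_extend_congr h.symm hg1 x w w' (by rwa [he2] at hw)))
  refine hQ.trans (integral_congr_ae (ae_of_all _ fun x => ?_))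
  have hx : Measurable fun w : G.edgeSet → ℝ => (x, w) := by fun_prop
  have h1 := measureReal_inter_of_dependsOn (μ := μ) (hx (measurableSet_avail_prod (G := G) k u v))
    (hx (measurableSet_avail_prod k v u))
    (S := Subtype.val ⁻¹' Explored G k u v) (T := Subtype.val ⁻¹' Explored G k v u)
    (fun w w' hw => avail_congr k u v x (extendWeights_congr hw))
    (fun w w' hw => avail_congr k v u x (extendWeights_congr hw))
    ((disjoint_explored_sides h hg).preimage _)
  have h2 := measureReal_avail (μ := μ) hdeg k h hg2 x
  have h3 := measureReal_avail (μ := μ) hdeg k h.symm hg2 x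
  have h4 : (Measure.pi fun _ : G.edgeSet => μ).real {w | Avail G (extendWeights w) k u v x ∧
      Avail G (extendWeights w) k v u x} = availProb μ d k x ^ 2 := by
    rw [sq]
    exact h1.trans (congrArg₂ (· * ·) h2 h3)
  simp only [h4]

theorem setIntegral_chain_le [NullSingletonClass μ] (hdeg : ∀ v, (G.neighborSet v).ncard = d + 1)
    (hid : Integrable (fun x : ℝ => x) μ) (h0 : ∀ᵐ x ∂μ, 0 ≤ x) (k : ℕ) {u v : V}
    (h : G.Adj u v) (hg : ((k + 1 : ℕ) : ℕ∞) < G.egirth) (e : G.edgeSet)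
    (he : (e : Sym2 V) = s(u, v)) :
    ∫ w in {w | Chain G (extendWeights w) k u v (w e)}, w e
        ∂(Measure.pi fun _ : G.edgeSet => μ) ≤
      (∫ x, x ∂μ) * ((d : ℝ) ^ k / k.factorial) := by
  have hg1 : ((k : ℕ) : ℕ∞) < G.egirth := lt_of_le_of_lt (by norm_cast; omega) hg
  have he1 : e = ⟨s(u, v), h⟩ := Subtype.ext he
  have hQ := setIntegral_eval_eq hid e (Q := fun x w => Chain G (extendWeights w) k u v x)
    (measurableSet_chain_prod (G := G) k u v) (fun x w w' hw =>
      (chain_extend_congr h hg x w w' (by rwa [he1] at hw)))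
  refine hQ.trans_le (integral_mul_le_of_le hid h0 (fun _ => measureReal_nonneg) fun x => ?_)
  exact (measureReal_chain_le hdeg k h hg1 x).trans (tail_bound_le k x)

/-- The contribution of an edge differs little from its value on the infinite regular tree. -/
theorem abs_setIntegral_bothAvail_sub_le [NullSingletonClass μ] (hd : 2 ≤ d)
    (hdeg : ∀ v, (G.neighborSet v).ncard = d + 1)
    (hid : Integrable (fun x : ℝ => x) μ) (h0 : ∀ᵐ x ∂μ, 0 ≤ x) (k : ℕ) {u v : V}
    (h : G.Adj u v) (hg : ((2 * k + 1 : ℕ) : ℕ∞) < G.egirth) (e : G.edgeSet)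
    (he : (e : Sym2 V) = s(u, v)) (m : ℕ) :
    |(∫ w in bothAvail (k + m) u v e, w e ∂(Measure.pi fun _ : G.edgeSet => μ)) -
        ∫ x, x * availProbLim μ d x ^ 2 ∂μ| ≤
      2 * ((∫ x, x ∂μ) * ((d : ℝ) ^ k / k.factorial)) := by
  classical
  set π := Measure.pi fun _ : G.edgeSet => μ
  have hg1 : ((k + 1 : ℕ) : ℕ∞) < G.egirth := lt_of_le_of_lt (by norm_cast; omega) hg
  have hint := integrable_eval (G := G) hid e
  have hnn := ae_eval_nonneg (G := G) h0 e
  have hC := setIntegral_bothAvail (μ := μ) hdeg hid k h hg e he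
  obtain ⟨hle, hlo, hl⟩ := integral_mul_availProb_sq_bounds (μ := μ) hd hid h0 k
  rw [← hC] at hle hlo hl
  have hK1 := setIntegral_chain_le (μ := μ) hdeg hid h0 k h hg1 e he
  have hK2 := setIntegral_chain_le (μ := μ) hdeg hid h0 k h.symm hg1 e (he.trans Sym2.eq_swap)
  have hmono {A B : Set (G.edgeSet → ℝ)} (hAB : A ⊆ B) : ∫ w in A, w e ∂π ≤ ∫ w in B, w e ∂π :=
    setIntegral_mono_set hint.integrableOn (ae_restrict_of_ae hnn) hAB.eventuallyLE
  have he' : Even k → bothAvail (k + m) u v e ⊆ bothAvail k u v e := fun hk w hw =>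
    ⟨(avail_add_of_even k m _ _ _).1 hk hw.1, (avail_add_of_even k m _ _ _).1 hk hw.2⟩
  have ho' : Odd k → bothAvail k u v e ⊆ bothAvail (k + m) u v e := fun hk w hw =>
    ⟨(avail_add_of_even k m _ _ _).2 hk hw.1, (avail_add_of_even k m _ _ _).2 hk hw.2⟩
  have hmK1 : MeasurableSet {w : G.edgeSet → ℝ | Chain G (extendWeights w) k u v (w e)} :=
    measurableSet_chain measurable_extendWeights k u v (measurable_pi_apply e)
  have hmK2 : MeasurableSet {w : G.edgeSet → ℝ | Chain G (extendWeights w) k v u (w e)} :=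
    measurableSet_chain measurable_extendWeights k v u (measurable_pi_apply e)
  have hmB (n) := measurableSet_bothAvail n u v e
  -- Outside the two chain events both truncations agree, so the difference of the indicators is at
  -- most the sum of the chain indicators.
  have hdiff : |(∫ w in bothAvail k u v e, w e ∂π) - ∫ w in bothAvail (k + m) u v e, w e ∂π| ≤
      2 * ((∫ x, x ∂μ) * ((d : ℝ) ^ k / k.factorial)) := by
    refine le_trans ?_ ((add_le_add hK1 hK2).trans_eq (two_mul _).symm)
    rw [← integral_indicator (hmB k), ← integral_indicator (hmB (k + m)),
      ← integral_indicator hmK1, ← integral_indicator hmK2,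
      ← integral_sub (hint.indicator (hmB k)) (hint.indicator (hmB (k + m))),
      ← integral_add (hint.indicator hmK1) (hint.indicator hmK2)]
    rw [← Real.norm_eq_abs]
    refine norm_integral_le_of_norm_le ((hint.indicator hmK1).add (hint.indicator hmK2)) ?_
    filter_upwards [hnn] with w hw
    by_cases h1 : Chain G (extendWeights w) k u v (w e)
    · have hK : (0 : ℝ) ≤ indicator {w : G.edgeSet → ℝ | Chain G (extendWeights w) k v u (w e)}
          (fun w => w e) w := indicator_apply_nonneg fun _ => hw
      rw [indicator_of_mem (s := {w : G.edgeSet → ℝ | Chain G (extendWeights w) k u v (w e)}) h1]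
      refine le_add_of_le_of_nonneg ?_ hK
      by_cases h2 : w ∈ bothAvail k u v e <;> by_cases h3 : w ∈ bothAvail (k + m) u v e <;>
        simp [h2, h3, abs_of_nonneg hw, hw]
    · by_cases h2 : Chain G (extendWeights w) k v u (w e)
      · have hK : (0 : ℝ) ≤ indicator {w : G.edgeSet → ℝ | Chain G (extendWeights w) k u v (w e)}
          (fun w => w e) w := indicator_apply_nonneg fun _ => hw
        rw [indicator_of_mem (s := {w : G.edgeSet → ℝ | Chain G (extendWeights w) k v u (w e)}) h2]
        refine le_add_of_nonneg_of_le hK ?_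
        by_cases h2 : w ∈ bothAvail k u v e <;> by_cases h3 : w ∈ bothAvail (k + m) u v e <;>
          simp [h2, h3, abs_of_nonneg hw, hw]
      · have h3 : w ∈ bothAvail k u v e ↔ w ∈ bothAvail (k + m) u v e :=
          and_congr (not_not.1 fun hne => h1 (chain_of_avail_ne k m _ _ _ hne))
            (not_not.1 fun hne => h2 (chain_of_avail_ne k m _ _ _ hne))
        have h4 : (0 : ℝ) ≤ indicator {w : G.edgeSet → ℝ | Chain G (extendWeights w) k u v (w e)}
          (fun w => w e) w := indicator_apply_nonneg fun _ => hw
        have h5 : (0 : ℝ) ≤ indicator {w : G.edgeSet → ℝ | Chain G (extendWeights w) k v u (w e)}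
          (fun w => w e) w := indicator_apply_nonneg fun _ => hw
        simp only [indicator, h3, sub_self, norm_zero]
        exact add_nonneg h4 h5
  -- The parity of `k` puts the deep value and the tree limit on the same side of the level-`k`
  -- value, each within the bound of it. Hence their distance is at most the bound, not twice it.
  rw [abs_le] at hdiff hl ⊢
  rcases Nat.even_or_odd k with hk | hk
  · have h1 := hmono (he' hk)
    have h2 := hle hk
    constructor <;> linarith [hdiff.1, hdiff.2, hl.1, hl.2]
  · have h1 := hmono (ho' hk)
    have h2 := hlo hk
    constructor <;> linarith [hdiff.1, hdiff.2, hl.1, hl.2]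

end EdgeEstimate

/-! ### Summation over the edges and the main term -/

section Expectation

open Set

variable {μ : Measure ℝ} [IsProbabilityMeasure μ] {d : ℕ} {V : Type*} {G : SimpleGraph V}

theorem two_mul_card_edgeSet [Finite V] [Fintype G.edgeSet]
    (hdeg : ∀ v, (G.neighborSet v).ncard = d + 1) :
    2 * Fintype.card G.edgeSet = Nat.card V * (d + 1) := by
  classical
  have := Fintype.ofFinite V
  have h := G.sum_degrees_eq_twice_card_edges
  rw [Finset.sum_congr rfl fun v _ => (degree_eq_ncard G v).trans (hdeg v), Finset.sum_const,
    Finset.card_univ, smul_eq_mul, ← Nat.card_eq_fintype_card, ← Set.ncard_coe_finset,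
    SimpleGraph.coe_edgeFinset] at h
  rw [← Nat.card_eq_fintype_card, Nat.card_coe_set_eq]
  exact h.symm

theorem abs_expectedGreedyWeight_sub_le [Finite V] [Nonempty V] [NullSingletonClass μ]
    (hd : 2 ≤ d) (hdeg : ∀ v, (G.neighborSet v).ncard = d + 1)
    (hid : Integrable (fun x : ℝ => x) μ) (h0 : ∀ᵐ x ∂μ, 0 ≤ x) (k : ℕ)
    (hg : ((2 * k + 1 : ℕ) : ℕ∞) < G.egirth) :
    |expectedGreedyWeight μ G - ((d : ℝ) + 1) / 2 * ∫ x, x * availProbLim μ d x ^ 2 ∂μ| ≤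
      (∫ x, x ∂μ) * (((d : ℝ) + 1) * (d : ℝ) ^ k / k.factorial) := by
  classical
  let _ := Fintype.ofFinite G.edgeSet
  have hends : ∀ e : G.edgeSet, ∃ u v, G.Adj u v ∧ (e : Sym2 V) = s(u, v) := by
    rintro ⟨e, he⟩
    induction e using Sym2.ind with
    | _ u v => exact ⟨u, v, he, rfl⟩
  choose a b hadj hab using hends
  -- At least the number of edges, so availability is exact; at least `k`, so it can be compared
  -- with level `k`.
  set N := k + G.edgeSet.ncard with hN
  have hgw : ∀ᵐ w ∂(Measure.pi fun _ : G.edgeSet => μ), greedyWeight G w / (Nat.card V : ℝ) =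
      (∑ e, (bothAvail N (a e) (b e) e).indicator (fun w => w e) w) / (Nat.card V : ℝ) := by
    filter_upwards [ae_injective_weights] with w hw
    congr 1
    have hmem (e : G.edgeSet) : e ∈ greedyMatching G w ↔ w ∈ bothAvail N (a e) (b e) e := by
      have h1 := mem_greedyMatching_iff_avail (w := extendWeights w) hw
        (fun e => extendWeights_apply w e e.2) (Nat.le_add_left _ k) (a e) (b e) (hadj e)
      have h2 : (⟨s(a e, b e), hadj e⟩ : G.edgeSet) = e := Subtype.ext (hab e).symm
      rw [h2] at h1
      have h3 : extendWeights w s(a e, b e) = w e := by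
        rw [← hab e, extendWeights_apply w e e.2]
      rw [h3] at h1
      exact h1
    rw [greedyWeight, ← Finset.sum_filter_add_sum_filter_not Finset.univ
      (fun e => e ∈ greedyMatching G w) (fun e => (bothAvail N (a e) (b e) e).indicator _ w)]
    rw [Finset.sum_eq_zero (s := Finset.univ.filter fun e => e ∉ greedyMatching G w), add_zero]
    · refine Finset.sum_congr (by ext; simp) fun e he => ?_
      rw [indicator_of_mem ((hmem e).1 (by simpa using he))]
    · intro e he
      rw [indicator_of_notMem]
      rw [← hmem]
      simpa using he
  have hE : expectedGreedyWeight μ G = (∑ e, ∫ w in bothAvail N (a e) (b e) e, w e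
      ∂(Measure.pi fun _ : G.edgeSet => μ)) / (Nat.card V : ℝ) := by
    rw [expectedGreedyWeight, integral_congr_ae hgw, integral_div, integral_finsetSum]
    · congr 1
      exact Finset.sum_congr rfl fun e _ => integral_indicator (measurableSet_bothAvail _ _ _ _)
    · exact fun e _ => (integrable_eval hid e).indicator (measurableSet_bothAvail _ _ _ _)
  set M := ∫ x, x * availProbLim μ d x ^ 2 ∂μ
  set ε := 2 * ((∫ x, x ∂μ) * ((d : ℝ) ^ k / k.factorial)) with hε
  have hn : (0 : ℝ) < Nat.card V := by exact_mod_cast Nat.card_pos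
  have hcard : 2 * (Fintype.card G.edgeSet : ℝ) = Nat.card V * ((d : ℝ) + 1) := by
    exact_mod_cast two_mul_card_edgeSet hdeg
  have hM : ((d : ℝ) + 1) / 2 * M = (∑ _e : G.edgeSet, M) / (Nat.card V : ℝ) := by
    rw [Finset.sum_const, Finset.card_univ, nsmul_eq_mul, eq_div_iff hn.ne']
    linear_combination (-M / 2) * hcard
  have hR : (∫ x, x ∂μ) * (((d : ℝ) + 1) * (d : ℝ) ^ k / k.factorial) =
      (∑ _e : G.edgeSet, ε) / (Nat.card V : ℝ) := by
    rw [Finset.sum_const, Finset.card_univ, nsmul_eq_mul, eq_div_iff hn.ne', hε]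
    linear_combination (-((∫ x, x ∂μ) * ((d : ℝ) ^ k / k.factorial))) * hcard
  rw [hE, hM, hR, ← sub_div, ← Finset.sum_sub_distrib, abs_div, abs_of_pos hn]
  refine div_le_div_of_nonneg_right ((Finset.abs_sum_le_sum_abs _ _).trans
    (Finset.sum_le_sum fun e _ => ?_)) hn.le
  exact abs_setIntegral_bothAvail_sub_le hd hdeg hid h0 k (hadj e) hg e (hab e) _

/-- With `r = d + 1`, the base `r - 1 - (r - 2)F` equals `1 + (d - 1)T`, and squaring the limit
doubles the exponent. Restricting to `x > 0` loses only a null set, as `0` is not an atom. -/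
theorem matchingMain_eq [NullSingletonClass μ] {f : ℝ → ℝ} (hf : Measurable f)
    (hf0 : ∀ x, 0 ≤ f x) (hμ : μ = volume.withDensity fun x => ENNReal.ofReal (f x))
    (h0 : ∀ᵐ x ∂μ, 0 ≤ x) (hd : 2 ≤ d) :
    matchingMain μ f (d + 1) = ((d : ℝ) + 1) / 2 * ∫ x, x * availProbLim μ d x ^ 2 ∂μ := by
  have hd' : (2 : ℝ) ≤ d := by exact_mod_cast hd
  have hpos : (Ioi 0 : Set ℝ) =ᵐ[μ] univ := by
    rw [ae_eq_univ, compl_Ioi, ← Iio_union_Icc_eq_Iic (le_refl (0 : ℝ)), Icc_self]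
    refine measure_union_null ?_ (measure_singleton 0)
    rw [ae_iff] at h0
    simpa [Iio_def] using h0
  have hlim (x : ℝ) : ((((d + 1 : ℕ) : ℝ) - 1) - (((d + 1 : ℕ) : ℝ) - 2) * cdf μ x) ^
      (-(2 * (((d + 1 : ℕ) : ℝ) - 1) / (((d + 1 : ℕ) : ℝ) - 2))) = availProbLim μ d x ^ 2 := by
    have hF : 0 ≤ μ.real (Ioi x) := measureReal_nonneg
    have hb : 0 ≤ 1 + ((d : ℝ) - 1) * μ.real (Ioi x) := by nlinarith
    rw [availProbLim, ← Real.rpow_natCast, ← Real.rpow_mul hb]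
    have h1 : cdf μ x = 1 - μ.real (Ioi x) := by rw [real_Ioi_eq_one_sub_cdf]; ring
    rw [h1]
    push_cast
    congr 1
    · ring
    · have : (d : ℝ) - 1 ≠ 0 := by linarith
      have : (d : ℝ) + 1 - 2 = d - 1 := by ring
      rw [this]
      field_simp
      ring
  rw [matchingMain, ← setIntegral_univ (μ := μ), ← setIntegral_congr_set hpos]
  have hden : ∫ x in Ioi (0 : ℝ), x * availProbLim μ d x ^ 2 ∂μ =
      ∫ x in Ioi (0 : ℝ), (ENNReal.ofReal (f x)).toReal • (x * availProbLim μ d x ^ 2) := by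
    rw [← setIntegral_withDensity_eq_setIntegral_toReal_smul hf.ennreal_ofReal
      (ae_of_all _ fun _ => ENNReal.ofReal_lt_top) _ measurableSet_Ioi, ← hμ]
  rw [hden]
  push_cast
  congr 1
  refine setIntegral_congr_fun measurableSet_Ioi fun x _ => ?_
  have := hlim x
  push_cast at this
  simp only [this, ENNReal.toReal_ofReal (hf0 x), smul_eq_mul]
  ring

end Expectation

theorem theorem2 {Ω : Type v} [MeasurableSpace Ω] (P : Measure Ω) [IsProbabilityMeasure P]
    (W : Ω → ℝ) (hW : Measurable W) (hW0 : ∀ᵐ ω ∂P, 0 ≤ W ω) (hWint : Integrable W P)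
    (f : ℝ → ℝ) (hf : Measurable f) (hf0 : ∀ x, 0 ≤ f x)
    (hWf : P.map W = volume.withDensity fun x => ENNReal.ofReal (f x))
    (g r : ℕ) (hg : 4 ≤ g) (hr : 3 ≤ r) :
    ((matchingMain (P.map W) f r - (∫ ω, W ω ∂P) *
          ((r : ℝ) * ((r : ℝ) - 1) ^ ((g - 2) / 2) / (Nat.factorial ((g - 2) / 2) : ℝ)) : ℝ) :
        EReal) ≤ sInf (greedyValues.{u} (P.map W) g r) ∧
    sInf (greedyValues.{u} (P.map W) g r) ≤ sSup (greedyValues.{u} (P.map W) g r) ∧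
    sSup (greedyValues.{u} (P.map W) g r) ≤
      ((matchingMain (P.map W) f r + (∫ ω, W ω ∂P) *
          ((r : ℝ) * ((r : ℝ) - 1) ^ ((g - 2) / 2) / (Nat.factorial ((g - 2) / 2) : ℝ)) : ℝ) :
        EReal) := by
  have : IsProbabilityMeasure (P.map W) := Measure.isProbabilityMeasure_map hW.aemeasurable
  have : NullSingletonClass (P.map W) := by rw [hWf]; infer_instance
  have h0 : ∀ᵐ x ∂(P.map W), 0 ≤ x := (ae_map_iff hW.aemeasurable measurableSet_Ici).2 hW0
  have hid : Integrable (fun x : ℝ => x) (P.map W) :=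
    (integrable_map_measure aestronglyMeasurable_id hW.aemeasurable).2 hWint
  have hmean : ∫ x, x ∂(P.map W) = ∫ ω, W ω ∂P :=
    integral_map hW.aemeasurable aestronglyMeasurable_id
  obtain ⟨d, rfl⟩ : ∃ d, r = d + 1 := ⟨r - 1, by omega⟩
  have hd : 2 ≤ d := by omega
  have key (V : Type u) [Finite V] [Nonempty V] (G : SimpleGraph V)
      (hG : RegularGirth G g (d + 1)) :
      |expectedGreedyWeight (P.map W) G - matchingMain (P.map W) f (d + 1)| ≤
        (∫ ω, W ω ∂P) * (((d + 1 : ℕ) : ℝ) * (((d + 1 : ℕ) : ℝ) - 1) ^ ((g - 2) / 2) /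
          (Nat.factorial ((g - 2) / 2) : ℝ)) := by
    obtain ⟨⟨_, hreg⟩, hgirth⟩ := hG
    rw [matchingMain_eq hf hf0 hWf h0 hd, ← hmean]
    -- The depth `⌊(g-2)/2⌋` satisfies `2k + 1 ≤ g - 1`, as the girth condition requires.
    have h := abs_expectedGreedyWeight_sub_le (μ := P.map W) (G := G) hd
      (fun v => (degree_eq_ncard G v).symm.trans (hreg v)) hid h0 ((g - 2) / 2)
      (lt_of_lt_of_le (by norm_cast; omega) hgirth)
    push_cast
    rwa [add_sub_cancel_right]
  refine ⟨le_sInf ?_, ?_, sSup_le ?_⟩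
  · rintro _ ⟨V, _, _, G, hG, rfl⟩
    have := (abs_le.1 (key V G hG)).1
    exact EReal.coe_le_coe_iff.2 (by linarith)
  · obtain ⟨V, h1, h2, G, hG⟩ := exists_regularGirth.{u} g (d + 1)
    have hmem : (expectedGreedyWeight (P.map W) G : EReal) ∈
        greedyValues.{u} (P.map W) g (d + 1) := ⟨V, h1, h2, G, hG, rfl⟩
    exact (sInf_le hmem).trans (le_sSup hmem)
  · rintro _ ⟨V, _, _, G, hG, rfl⟩
    have := (abs_le.1 (key V G hG)).2
    exact EReal.coe_le_coe_iff.2 (by linarith)
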